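/- Let $\xi_1,\xi_2,\dots$ be i.i.d. real random variables on a probability space $(\Omega,\mathcal F,\mathbf P)$ with $\mathbf E\xi_1\in[-\infty,0)$ and suppose that, for some $\gamma>0$, $\mathbf E e^{\gamma\xi_1}=1$ and $\mathbf E\,\xi_1e^{\gamma\xi_1}=\infty$. Put $S_n=\xi_1+\dots+\xi_n$, $S_0=0$, and $F(dx)=e^{\gamma x}\,\mathbf P(\xi_1\in dx)$. Let $\mathbf P^*$ be a probability measure on $(\Omega,\mathcal F)$ such that $\mathbf P^*(\Gamma)=\mathbf E\,e^{\gamma S_n}\mathbf 1_\Gamma$ for all $n\ge 0$ and all $\Gamma$ in the $\sigma$-algebra generated by $\xi_1,\dots,\xi_n$. For $r>0$ let $\tau^{(r)}=\min\{n: S_n\ge r\}$ and let $\chi^{(r)}=S_{\tau^{(r)}}-r$ be the overshoot of the walk over level $r$. Let $\alpha\in(0,1)$ and suppose that the right tail $x\mapsto F((x,\infty))$ is regularly varying at infinity with index $-\alpha$. Let $X=(X(t),\,t\ge 0)$, defined on a probability space $(\Omega',\mathcal F',\mathbf P')$, be an increasing pure-jump stable Lévy process starting at zero with Lévy measure $\alpha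 x^{-\alpha-1}\,dx$ on $(0,\infty)$ (that is, a driftless subordinator with this Lévy measure). Let $\tau=\inf\{t: X(t)\ge 1\}$ and $\chi=X(\tau)-1$. Then $\tau^{(r)}<\infty$ $\mathbf P^*$-a.s. for every $r>0$, $\tau<\infty$ $\mathbf P'$-a.s., and, as $r\to\infty$ through the reals, the random variables $\chi^{(r)}/r$ under $\mathbf P^*$ converge in distribution to $\chi$ under $\mathbf P'$. Moreover, the law of $\chi$ is absolutely continuous on $(0,\infty)$ with density $$\frac{\sin\pi\alpha}{\pi}\,x^{-\alpha}(1+x)^{-1},\qquad x>0.$$ -/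

import Mathlib

open MeasureTheory ProbabilityTheory Filter Set
open scoped NNReal ENNReal Topology

noncomputable section

namespace RandomWalkOvershoot

/-- `f` is regularly varying at infinity with index `ρ`. -/
structure IsRegularlyVarying (f : ℝ → ℝ) (ρ : ℝ) : Prop where
  measurable : Measurable f
  eventually_pos : ∀ᶠ x in atTop, 0 < f x
  tendsto_ratio : ∀ c : ℝ, 0 < c → Tendsto (fun x => f (c * x) / f x) atTop (𝓝 (c ^ ρ))

section Walk

variable {Ω : Type*}

/-- The random walk `S n = ξ 0 + ⋯ + ξ (n - 1)`. The steps are numbered from `0`. -/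
def walk (ξ : ℕ → Ω → ℝ) (n : ℕ) (ω : Ω) : ℝ := ∑ i ∈ Finset.range n, ξ i ω

/-- The `σ`-algebra generated by the first `n` steps. -/
@[reducible] def stepAlgebra (ξ : ℕ → Ω → ℝ) (n : ℕ) : MeasurableSpace Ω :=
  ⨆ i ∈ Finset.range n, MeasurableSpace.comap (ξ i) inferInstance

/-- `Q` is the exponentially tilted measure: on the `σ`-algebra of the first `n` steps it has
density `exp (γ S n)` with respect to `P`, for every `n`. -/
def IsTiltedMeasure [MeasurableSpace Ω] (P : Measure Ω) (ξ : ℕ → Ω → ℝ) (γ : ℝ)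
    (Q : Measure Ω) : Prop :=
  ∀ (n : ℕ) (Γ : Set Ω), MeasurableSet[stepAlgebra ξ n] Γ →
    Q Γ = ∫⁻ ω in Γ, ENNReal.ofReal (Real.exp (γ * walk ξ n ω)) ∂P

/-- The distribution `F(dx) = exp (γ x) P(Y ∈ dx)` on the real line. -/
def tiltedLaw [MeasurableSpace Ω] (P : Measure Ω) (Y : Ω → ℝ) (γ : ℝ) : Measure ℝ :=
  (P.map Y).withDensity (fun x => ENNReal.ofReal (Real.exp (γ * x)))

/-- The first time at which the walk attains level `r`; the value is irrelevant (namely `0`) on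
paths that never do. -/
def passageTime (ξ : ℕ → Ω → ℝ) (r : ℝ) (ω : Ω) : ℕ := sInf {n : ℕ | r ≤ walk ξ n ω}

/-- The overshoot of the walk over level `r`. -/
def walkOvershoot (ξ : ℕ → Ω → ℝ) (r : ℝ) (ω : Ω) : ℝ :=
  walk ξ (passageTime ξ r ω) ω - r

end Walk

section Subordinator

variable {Ω : Type*}

/-- `X` is an increasing pure-jump Lévy process started at zero with Lévy measure `ν`: a process
with stationary independent increments and nondecreasing right-continuous paths whose
Lévy–Khintchine (Laplace) exponent has no drift term and has Lévy measure `ν`. -/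
structure IsPureJumpSubordinator [MeasurableSpace Ω] (P : Measure Ω) (ν : Measure ℝ)
    (X : ℝ≥0 → Ω → ℝ) : Prop where
  measurable : ∀ t, Measurable (X t)
  start_zero : ∀ᵐ ω ∂P, X 0 ω = 0
  mono : ∀ᵐ ω ∂P, Monotone (fun t => X t ω)
  right_continuous : ∀ᵐ ω ∂P, ∀ t, ContinuousWithinAt (fun s => X s ω) (Ici t) t
  indep_increments : HasIndepIncrements X P
  stationary_increments : ∀ s t, IdentDistrib (fun ω => X (s + t) ω - X s ω) (X t) P P
  levy_pos : ν (Iic 0) = 0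
  levy_integrable : ∫⁻ x, ENNReal.ofReal (min 1 x) ∂ν < ∞
  laplace : ∀ (t : ℝ≥0) (u : ℝ), 0 ≤ u →
    ∫ ω, Real.exp (-(u * X t ω)) ∂P =
      Real.exp (-((t : ℝ) * ∫ x, (1 - Real.exp (-(u * x))) ∂ν))

/-- The measure `α x ^ (-α - 1) dx` on `(0, ∞)`. -/
def stableLevyMeasure (α : ℝ) : Measure ℝ :=
  (volume.restrict (Ioi 0)).withDensity (fun x => ENNReal.ofReal (α * x ^ (-α - 1)))

/-- `inf {t : X t ≥ 1}`; the value is irrelevant (namely `0`) on paths that stay below `1`. -/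
def hitOne (X : ℝ≥0 → Ω → ℝ) (ω : Ω) : ℝ≥0 := sInf {t : ℝ≥0 | 1 ≤ X t ω}

/-- The overshoot of the process `X` over level `1`. -/
def processOvershoot (X : ℝ≥0 → Ω → ℝ) (ω : Ω) : ℝ := X (hitOne X ω) ω - 1

end Subordinator

/-- The law on `(0, ∞)` with density `(sin πα / π) x ^ (-α) (1 + x)⁻¹`. -/
def dynkinLaw (α : ℝ) : Measure ℝ :=
  (volume.restrict (Ioi 0)).withDensity
    (fun x => ENNReal.ofReal (Real.sin (Real.pi * α) / Real.pi * x ^ (-α) * (1 + x)⁻¹))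

end RandomWalkOvershoot

end

open RandomWalkOvershoot

/-!
The proof treats the random walk and the subordinator in the same way, through a limit theorem of
Dynkin–Lamperti type for a family of walks with step laws `F i` and level `1`
(`tendsto_exitLaw_Ioi`). For the walk, `F r` is the law of `ξ / r` under the tilted measure; for the
subordinator, `F h` is the law of `X h`, so that the walk is a skeleton of `X`.

Let `U` be the renewal measure of a step law `F`. Decomposing the walk at its first passage over
level `1` (`lintegral_renewalMeasure`) gives
`P (overshoot > y) = ∫_{x < 1} F (1 + y - x, ∞) U(dx)`, up to an error of at most
`F (y, ∞) U (-∞, 0)`: once the walk is above level `1`, its expected time below that level is at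
most `U (-∞, 0)`. No ladder heights are needed. If the tails of `F i` are asymptotic to
`a i * z ^ (-α)` and `a i * U i` converges vaguely to the potential measure
`(sin πα / π) x ^ (α - 1) dx` on the half-line, the negative half-line being negligible, then the
limit is
`(sin πα / π) ∫_0^1 x ^ (α - 1) (1 + y - x) ^ (-α) dx`,
which is the tail of the claimed law (`dynkinLaw_Ioi`). The vague convergence comes from the Laplace
transform `1 / (1 - f)` of `U`, `f` being that of `F`, by the continuity theorem
`tendsto_integral_of_tendsto_laplaceTransform`, that is, by polynomial approximation in `exp (-x)`.

For the walk, `1 - f (u / r)` is asymptotic to `F (r, ∞) u ^ α Γ(1 - α)` by Potter's bound and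
dominated convergence, the left tail of `F` being exponentially light because it comes from a tilt
(`tendsto_one_sub_laplaceTransform_div`). For the subordinator, `f` is explicit, and the tail
asymptotics follow from it by the monotone density theorem
(`tendsto_antitone_of_tendsto_laplaceTransform`). Finally, by right-continuity of the paths the
overshoots of the skeletons converge to that of `X` almost surely
(`tendsto_walkOvershoot_skeletonStep`), so the latter has the law found for the limit.
-/

namespace RandomWalkOvershoot

/-! ### Renewal measure and killed walk of a step law -/

/-- The two-sided Laplace transform `∫ exp (-u x) μ(dx)` of a measure, with values in `[0, ∞]`. -/
noncomputable def laplaceTransform (μ : Measure ℝ) (u : ℝ) : ℝ≥0∞ :=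
  ∫⁻ x, ENNReal.ofReal (Real.exp (-(u * x))) ∂μ

/-- The law of the position after `n` steps of a walk with step law `F`. -/
noncomputable def convPow (F : Measure ℝ) : ℕ → Measure ℝ
  | 0 => Measure.dirac 0
  | n + 1 => (convPow F n).conv F

/-- The law of the position after `n` steps of a walk with step law `F`, on the event that all the
positions up to then are below level `1`. -/
noncomputable def killedLaw (F : Measure ℝ) : ℕ → Measure ℝ
  | 0 => Measure.dirac 0
  | n + 1 => ((killedLaw F n).conv F).restrict (Iio 1)

/-- The law of the position of the walk at the moment `n + 1`, on the event that this is the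
moment of first passage over level `1`. -/
noncomputable def exitStep (F : Measure ℝ) (n : ℕ) : Measure ℝ :=
  ((killedLaw F n).conv F).restrict (Ici 1)

/-- The law of the position of the walk at its first passage over level `1`. -/
noncomputable def exitLaw (F : Measure ℝ) : Measure ℝ := Measure.sum (exitStep F)

/-- The renewal measure: the expected number of visits of the walk to a set. -/
noncomputable def renewalMeasure (F : Measure ℝ) : Measure ℝ := Measure.sum (convPow F)

theorem killedLaw_add_exitStep (F : Measure ℝ) (n : ℕ) :
    killedLaw F (n + 1) + exitStep F n = (killedLaw F n).conv F := by
  rw [killedLaw, exitStep, ← compl_Iio, Measure.restrict_add_restrict_compl measurableSet_Iio]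

theorem antitone_tail (G : Measure ℝ) : Antitone fun z => G (Ioi z) :=
  fun _ _ h => measure_mono (Ioi_subset_Ioi h)

theorem measurable_tail_sub (F : Measure ℝ) (c : ℝ) : Measurable fun x => F (Ioi (c - x)) :=
  Monotone.measurable fun _ _ h => antitone_tail F (by linarith)

section

variable (F : Measure ℝ) [IsProbabilityMeasure F]

instance isProbabilityMeasure_convPow (n : ℕ) : IsProbabilityMeasure (convPow F n) := by
  induction n with
  | zero => unfold convPow; infer_instance
  | succ n ih => unfold convPow; infer_instance

instance isFiniteMeasure_killedLaw (n : ℕ) : IsFiniteMeasure (killedLaw F n) := by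
  induction n with
  | zero => unfold killedLaw; infer_instance
  | succ n ih => unfold killedLaw; infer_instance

instance isFiniteMeasure_exitStep (n : ℕ) : IsFiniteMeasure (exitStep F n) := by
  unfold exitStep; infer_instance

theorem laplaceTransform_convPow (u : ℝ) (n : ℕ) :
    laplaceTransform (convPow F n) u = laplaceTransform F u ^ n := by
  induction n with
  | zero => simp [convPow, laplaceTransform]
  | succ n ih =>
    rw [pow_succ, ← ih]
    unfold laplaceTransform
    rw [convPow, Measure.lintegral_conv (by fun_prop), ← lintegral_mul_const _ (by fun_prop)]
    refine lintegral_congr fun x => ?_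
    rw [← lintegral_const_mul _ (by fun_prop)]
    refine lintegral_congr fun y => ?_
    rw [← ENNReal.ofReal_mul (Real.exp_nonneg _), ← Real.exp_add]
    ring_nf

theorem laplaceTransform_renewalMeasure (u : ℝ) :
    laplaceTransform (renewalMeasure F) u = (1 - laplaceTransform F u)⁻¹ := by
  rw [laplaceTransform, renewalMeasure, lintegral_sum_measure]
  exact (tsum_congr (laplaceTransform_convPow F u)).trans (ENNReal.tsum_geometric _)

/-- The position of the walk, decomposed at the first passage over level `1`. -/
theorem convPow_succ_eq (n : ℕ) :
    convPow F (n + 1) = killedLaw F (n + 1) +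
      ∑ p ∈ Finset.HasAntidiagonal.antidiagonal n, (exitStep F p.1).conv (convPow F p.2) := by
  induction n with
  | zero =>
    have := killedLaw_add_exitStep F 0
    simp only [Finset.Nat.antidiagonal_zero, Finset.sum_singleton, convPow, Measure.conv_dirac_zero,
      zero_add] at this ⊢
    rw [this, killedLaw]
  | succ n ih =>
    rw [convPow, ih, Measure.add_conv, killedLaw_add_exitStep F (n + 1) |>.symm,
      Finset.Nat.antidiagonal_succ', Finset.sum_cons, Finset.sum_map]
    have h : (∑ p ∈ Finset.HasAntidiagonal.antidiagonal n,
        (exitStep F p.1).conv (convPow F p.2)).conv F =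
        ∑ p ∈ Finset.HasAntidiagonal.antidiagonal n,
          (exitStep F p.1).conv (convPow F (p.2 + 1)) := by
      refine Measure.ext_of_lintegral _ fun f hf => ?_
      rw [Measure.lintegral_conv hf, lintegral_finsetSum_measure, lintegral_finsetSum_measure]
      refine Finset.sum_congr rfl fun p _ => ?_
      rw [convPow, ← Measure.conv_assoc, Measure.lintegral_conv hf]
    rw [h]
    simp [convPow, add_assoc]

theorem lintegral_convPow_succ (n : ℕ) (f : ℝ → ℝ≥0∞) :
    ∫⁻ x, f x ∂(convPow F (n + 1)) = ∫⁻ x, f x ∂(killedLaw F (n + 1)) +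
      ∑ p ∈ Finset.HasAntidiagonal.antidiagonal n,
        ∫⁻ x, f x ∂((exitStep F p.1).conv (convPow F p.2)) := by
  rw [convPow_succ_eq, lintegral_add_measure, lintegral_finsetSum_measure]

theorem killedLaw_univ_add_sum (n : ℕ) :
    killedLaw F n univ + ∑ k ∈ Finset.range n, exitStep F k univ = 1 := by
  induction n with
  | zero => simp [killedLaw]
  | succ n ih =>
    have h := congrArg (fun μ => μ univ) (killedLaw_add_exitStep F n)
    have h' : (killedLaw F n).conv F univ = killedLaw F n univ := by
      rw [← lintegral_one, Measure.lintegral_conv (by fun_prop)]; simp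
    simp only [Measure.add_apply, h'] at h
    rw [Finset.sum_range_succ, ← ih, ← h]
    ring

theorem exitLaw_univ_le : exitLaw F univ ≤ 1 := by
  rw [exitLaw, Measure.sum_apply _ MeasurableSet.univ]
  refine ENNReal.tsum_le_of_sum_range_le fun n => ?_
  rw [← killedLaw_univ_add_sum F n]
  exact le_add_self

/-- The renewal measure, decomposed at the first passage over level `1`. -/
theorem lintegral_renewalMeasure {f : ℝ → ℝ≥0∞} (hf : Measurable f) :
    ∫⁻ x, f x ∂(renewalMeasure F) = ∑' n, ∫⁻ x, f x ∂(killedLaw F n) +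
      ∫⁻ x, ∫⁻ y, f (x + y) ∂(renewalMeasure F) ∂(exitLaw F) := by
  have h1 : ∫⁻ x, ∫⁻ y, f (x + y) ∂(renewalMeasure F) ∂(exitLaw F) =
      ∑' n, ∑ p ∈ Finset.HasAntidiagonal.antidiagonal n,
        ∫⁻ x, f x ∂((exitStep F p.1).conv (convPow F p.2)) := by
    simp_rw [exitLaw, renewalMeasure, lintegral_sum_measure]
    have (k : ℕ) : ∫⁻ x, ∑' m, ∫⁻ y, f (x + y) ∂(convPow F m) ∂(exitStep F k) =
        ∑' m, ∫⁻ x, f x ∂((exitStep F k).conv (convPow F m)) := by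
      rw [lintegral_tsum]
      · exact tsum_congr fun m => (Measure.lintegral_conv hf).symm
      · intro m
        exact (Measurable.lintegral_prod_right' (f := fun p : ℝ × ℝ => f (p.1 + p.2))
          (by fun_prop)).aemeasurable
    simp_rw [this]
    rw [← ENNReal.tsum_prod, ← Finset.HasAntidiagonal.sigmaAntidiagonalEquivProd.tsum_eq,
      ENNReal.tsum_sigma']
    refine tsum_congr fun n => ?_
    rw [tsum_fintype]
    exact Finset.sum_coe_sort (Finset.HasAntidiagonal.antidiagonal n)
      fun p => ∫⁻ x, f x ∂((exitStep F p.1).conv (convPow F p.2))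
  rw [h1, renewalMeasure, lintegral_sum_measure, tsum_eq_zero_add' ENNReal.summable,
    tsum_eq_zero_add' (f := fun n => ∫⁻ x, f x ∂(killedLaw F n)) ENNReal.summable]
  simp_rw [lintegral_convPow_succ]
  rw [ENNReal.tsum_add, add_assoc]
  rfl

theorem killedLaw_Ici (F : Measure ℝ) (n : ℕ) : killedLaw F n (Ici 1) = 0 := by
  cases n with
  | zero => simp [killedLaw]
  | succ n =>
    rw [killedLaw, Measure.restrict_apply measurableSet_Ici, Ici_inter_Iio, Ico_self,
      measure_empty]

theorem exitLaw_Ioi {y : ℝ} (hy : 0 ≤ y) :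
    exitLaw F (Ioi (1 + y)) = ∑' n, ∫⁻ x, F (Ioi (1 + y - x)) ∂(killedLaw F n) := by
  rw [exitLaw, Measure.sum_apply _ measurableSet_Ioi]
  refine tsum_congr fun n => ?_
  have hs : Ioi (1 + y) ∩ Ici 1 = Ioi (1 + y) := by
    refine inter_eq_left.2 fun x hx => ?_
    rw [mem_Ioi] at hx
    rw [mem_Ici]
    linarith
  rw [exitStep, Measure.restrict_apply measurableSet_Ioi, hs,
    ← lintegral_indicator_one measurableSet_Ioi,
    Measure.lintegral_conv (measurable_one.indicator measurableSet_Ioi)]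
  refine lintegral_congr fun x => ?_
  rw [← lintegral_indicator_one measurableSet_Ioi]
  refine lintegral_congr fun z => ?_
  simp [indicator, sub_lt_iff_lt_add']

theorem lintegral_killedLaw_indicator (F : Measure ℝ) (n : ℕ) (f : ℝ → ℝ≥0∞) :
    ∫⁻ x, (Iio 1).indicator f x ∂(killedLaw F n) = ∫⁻ x, f x ∂(killedLaw F n) := by
  refine lintegral_congr_ae ?_
  have : ∀ᵐ x ∂(killedLaw F n), x ∉ Ici (1 : ℝ) :=
    measure_eq_zero_iff_ae_notMem.1 (killedLaw_Ici F n)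
  filter_upwards [this] with x hx
  rw [indicator_of_mem]
  simpa using hx

theorem setLIntegral_renewalMeasure {y : ℝ} (hy : 0 ≤ y) :
    ∫⁻ x in Iio 1, F (Ioi (1 + y - x)) ∂(renewalMeasure F) = exitLaw F (Ioi (1 + y)) +
      ∫⁻ x, ∫⁻ z, (Iio 1).indicator (fun x => F (Ioi (1 + y - x))) (x + z)
        ∂(renewalMeasure F) ∂(exitLaw F) := by
  rw [← lintegral_indicator measurableSet_Iio,
    lintegral_renewalMeasure F ((measurable_tail_sub F _).indicator measurableSet_Iio),
    exitLaw_Ioi F hy]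
  simp_rw [lintegral_killedLaw_indicator]

/-- Once above level `1`, the walk spends on average at most `renewalMeasure F (Iio 0)` units of
time below it, so ignoring the killing costs little. -/
theorem setLIntegral_renewalMeasure_le {y : ℝ} (hy : 0 ≤ y) :
    ∫⁻ x in Iio 1, F (Ioi (1 + y - x)) ∂(renewalMeasure F) ≤ exitLaw F (Ioi (1 + y)) +
      F (Ioi y) * renewalMeasure F (Iio 0) := by
  rw [setLIntegral_renewalMeasure F hy]
  gcongr
  have hae : ∀ᵐ x ∂(exitLaw F), 1 ≤ x := by
    rw [exitLaw, Measure.ae_sum_iff]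
    intro n
    exact ae_restrict_mem measurableSet_Ici
  calc ∫⁻ x, ∫⁻ z, (Iio 1).indicator (fun x => F (Ioi (1 + y - x))) (x + z)
        ∂(renewalMeasure F) ∂(exitLaw F)
      ≤ ∫⁻ _, F (Ioi y) * renewalMeasure F (Iio 0) ∂(exitLaw F) := by
        refine lintegral_mono_ae ?_
        filter_upwards [hae] with x hx
        rw [← setLIntegral_const, ← lintegral_indicator measurableSet_Iio]
        refine lintegral_mono fun z => ?_
        by_cases h : x + z < 1
        · rw [indicator_of_mem (by simpa using h), indicator_of_mem (by simp; linarith)]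
          exact antitone_tail F (by linarith)
        · rw [indicator_of_notMem (by simpa using h)]
          exact zero_le
    _ ≤ F (Ioi y) * renewalMeasure F (Iio 0) := by
        rw [lintegral_const]
        exact mul_le_of_le_one_right' (exitLaw_univ_le F)

theorem exitLaw_Ioi_le {y : ℝ} (hy : 0 ≤ y) :
    exitLaw F (Ioi (1 + y)) ≤ ∫⁻ x in Iio 1, F (Ioi (1 + y - x)) ∂(renewalMeasure F) := by
  rw [setLIntegral_renewalMeasure F hy]
  exact le_self_add

end

/-! ### Overshoot of a walk and the exit law -/

section

variable {Ω : Type*} [MeasurableSpace Ω]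

/-- Under `Q` the `ξ n` are independent with law `F`, in the form in which this is used: each step
has law `F` and is independent of the steps before it. -/
def HasIndepSteps (Q : Measure Ω) (ξ : ℕ → Ω → ℝ) (F : Measure ℝ) : Prop :=
  ∀ (n : ℕ) (A : Set Ω) (B : Set ℝ), MeasurableSet[stepAlgebra ξ n] A → MeasurableSet B →
    Q (A ∩ ξ n ⁻¹' B) = Q A * F B

theorem measurable_walk {ξ : ℕ → Ω → ℝ} (hξ : ∀ i, Measurable (ξ i)) (n : ℕ) :
    Measurable (walk ξ n) := by
  unfold walk; fun_prop

theorem measurable_walk_stepAlgebra {Ω : Type*} (ξ : ℕ → Ω → ℝ) {k n : ℕ} (hkn : k ≤ n) :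
    Measurable[stepAlgebra ξ n] (walk ξ k) := by
  have : ∀ i ∈ Finset.range k, Measurable[stepAlgebra ξ n] (ξ i) := fun i hi => by
    have h : MeasurableSpace.comap (ξ i) inferInstance ≤ stepAlgebra ξ n :=
      le_iSup₂_of_le i (Finset.range_mono hkn hi) le_rfl
    exact (comap_measurable (ξ i)).mono h le_rfl
  unfold walk
  exact Finset.measurable_fun_sum _ this

theorem stepAlgebra_le {ξ : ℕ → Ω → ℝ} (hξ : ∀ i, Measurable (ξ i)) (n : ℕ) :
    stepAlgebra ξ n ≤ ‹MeasurableSpace Ω› :=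
  iSup₂_le fun i _ => (hξ i).comap_le

theorem walk_succ {Ω : Type*} (ξ : ℕ → Ω → ℝ) (n : ℕ) (ω : Ω) :
    walk ξ (n + 1) ω = walk ξ n ω + ξ n ω := Finset.sum_range_succ _ _

/-- The event that the positions at the times `0, …, n` are all below level `1`. -/
def belowSet (ξ : ℕ → Ω → ℝ) (n : ℕ) : Set Ω := ⋂ k ∈ Finset.range (n + 1), walk ξ k ⁻¹' Iio 1

theorem measurableSet_belowSet {Ω : Type*} (ξ : ℕ → Ω → ℝ) (n : ℕ) :
    MeasurableSet[stepAlgebra ξ n] (belowSet ξ n) :=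
  MeasurableSet.biInter (Finset.range (n + 1)).countable_toSet fun k hk =>
    measurable_walk_stepAlgebra ξ (by simpa [Nat.lt_succ_iff] using hk) measurableSet_Iio

variable {Q : Measure Ω} {ξ : ℕ → Ω → ℝ} {F : Measure ℝ}

theorem HasIndepSteps.map_walk_succ [IsProbabilityMeasure Q] [IsProbabilityMeasure F]
    (h : HasIndepSteps Q ξ F) (hξ : ∀ i, Measurable (ξ i)) (n : ℕ) {A : Set Ω}
    (hA : MeasurableSet[stepAlgebra ξ n] A) :
    (Q.restrict A).map (walk ξ (n + 1)) = ((Q.restrict A).map (walk ξ n)).conv F := by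
  have hA' := stepAlgebra_le hξ n _ hA
  have hw := measurable_walk hξ n
  have hprod : (Q.restrict A).map (fun ω => (walk ξ n ω, ξ n ω)) =
      ((Q.restrict A).map (walk ξ n)).prod F := by
    refine (Measure.prod_eq fun s t hs ht => ?_).symm
    rw [Measure.map_apply (by fun_prop) (hs.prod ht), Measure.map_apply hw hs,
      Measure.restrict_apply ((hw.prodMk (hξ n)) (hs.prod ht)), Measure.restrict_apply (hw hs),
      ← h n _ t ((measurable_walk_stepAlgebra ξ le_rfl hs).inter hA) ht]
    congr 1
    ext ω
    simp only [mem_inter_iff, mem_preimage, mem_prod]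
    tauto
  rw [Measure.conv, ← hprod, Measure.map_map (by fun_prop) (by fun_prop)]
  congr 1
  ext ω
  exact walk_succ ξ n ω

theorem belowSet_succ {Ω : Type*} (ξ : ℕ → Ω → ℝ) (n : ℕ) :
    belowSet ξ (n + 1) = walk ξ (n + 1) ⁻¹' Iio 1 ∩ belowSet ξ n := by
  rw [belowSet, Finset.range_add_one, Finset.set_biInter_insert]
  rfl

theorem HasIndepSteps.map_walk_belowSet [IsProbabilityMeasure Q] [IsProbabilityMeasure F]
    (h : HasIndepSteps Q ξ F) (hξ : ∀ i, Measurable (ξ i)) (n : ℕ) :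
    (Q.restrict (belowSet ξ n)).map (walk ξ n) = killedLaw F n := by
  induction n with
  | zero =>
    have h0 : walk ξ 0 = fun _ => 0 := by ext; simp [walk]
    have h1 : belowSet ξ 0 = univ := by simp [belowSet, h0]
    rw [h0, h1, Measure.map_const, killedLaw]
    simp
  | succ n ih =>
    have hw := measurable_walk hξ (n + 1)
    rw [killedLaw, ← ih, ← h.map_walk_succ hξ n (measurableSet_belowSet ξ n),
      Measure.restrict_map hw measurableSet_Iio, Measure.restrict_restrict (hw measurableSet_Iio),
      belowSet_succ]

theorem HasIndepSteps.map_walk [IsProbabilityMeasure Q] [IsProbabilityMeasure F]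
    (h : HasIndepSteps Q ξ F) (hξ : ∀ i, Measurable (ξ i)) (n : ℕ) :
    Q.map (walk ξ n) = convPow F n := by
  induction n with
  | zero =>
    have h0 : walk ξ 0 = fun _ => 0 := by ext; simp [walk]
    rw [h0, Measure.map_const, convPow]
    simp
  | succ n ih =>
    have := h.map_walk_succ hξ n (A := univ) MeasurableSet.univ
    rwa [Measure.restrict_univ, ih] at this

theorem measure_first_passage [IsProbabilityMeasure Q] [IsProbabilityMeasure F]
    (h : HasIndepSteps Q ξ F) (hξ : ∀ i, Measurable (ξ i)) (n : ℕ) {y : ℝ} (hy : 0 ≤ y) :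
    Q (belowSet ξ n ∩ walk ξ (n + 1) ⁻¹' Ioi (1 + y)) = exitStep F n (Ioi (1 + y)) := by
  have hw := measurable_walk hξ (n + 1)
  have hs : Ioi (1 + y) ∩ Ici 1 = Ioi (1 + y) := by
    refine inter_eq_left.2 fun x hx => ?_
    rw [mem_Ioi] at hx
    rw [mem_Ici]
    linarith
  rw [exitStep, Measure.restrict_apply measurableSet_Ioi, hs, ← h.map_walk_belowSet hξ,
    ← h.map_walk_succ hξ n (measurableSet_belowSet ξ n), Measure.map_apply hw measurableSet_Ioi,
    Measure.restrict_apply (hw measurableSet_Ioi), inter_comm]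

theorem belowSet_inter_iff_passageTime_eq {Ω : Type*} (ξ : ℕ → Ω → ℝ) (n : ℕ) (ω : Ω) :
    ω ∈ belowSet ξ n ∩ walk ξ (n + 1) ⁻¹' Ici 1 ↔ passageTime ξ 1 ω = n + 1 := by
  simp only [belowSet, mem_inter_iff, mem_iInter, Finset.mem_range, mem_preimage, mem_Iio, mem_Ici,
    Nat.lt_succ_iff]
  constructor
  · rintro ⟨h1, h2⟩
    refine le_antisymm (Nat.sInf_le h2) ?_
    refine le_csInf ⟨_, h2⟩ fun k hk => ?_
    by_contra hlt
    exact absurd (h1 k (by omega)) (not_lt.2 hk)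
  · intro h
    have hne : {m : ℕ | 1 ≤ walk ξ m ω}.Nonempty := Nat.nonempty_of_pos_sInf
      (by unfold passageTime at h; omega)
    constructor
    · intro k hk
      by_contra hk'
      have : passageTime ξ 1 ω ≤ k := Nat.sInf_le (not_lt.1 hk')
      omega
    · rw [← h]; exact Nat.sInf_mem hne

theorem overshoot_gt_eq_iUnion {Ω : Type*} (ξ : ℕ → Ω → ℝ) {y : ℝ} (hy : 0 ≤ y) :
    {ω | y < walkOvershoot ξ 1 ω} =
      ⋃ n, belowSet ξ n ∩ walk ξ (n + 1) ⁻¹' Ioi (1 + y) := by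
  ext ω
  simp only [mem_ofPred_eq, mem_iUnion]
  constructor
  · intro h
    unfold walkOvershoot at h
    obtain h0 | ⟨n, hn⟩ : passageTime ξ 1 ω = 0 ∨ ∃ n, passageTime ξ 1 ω = n + 1 := by
      cases passageTime ξ 1 ω <;> simp
    · rw [h0] at h
      simp only [walk, Finset.range_zero, Finset.sum_empty] at h
      linarith
    · refine ⟨_, ((belowSet_inter_iff_passageTime_eq ξ _ ω).2 hn).1, ?_⟩
      rw [hn] at h
      simp only [mem_preimage, mem_Ioi]
      linarith
  · rintro ⟨n, h1, h2⟩
    simp only [mem_preimage, mem_Ioi] at h2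
    have := (belowSet_inter_iff_passageTime_eq ξ n ω).1
      ⟨h1, by simp only [mem_preimage, mem_Ici]; linarith⟩
    rw [walkOvershoot, this]
    linarith

theorem measure_walkOvershoot_gt [IsProbabilityMeasure Q] [IsProbabilityMeasure F]
    (h : HasIndepSteps Q ξ F) (hξ : ∀ i, Measurable (ξ i)) {y : ℝ} (hy : 0 ≤ y) :
    Q {ω | y < walkOvershoot ξ 1 ω} = exitLaw F (Ioi (1 + y)) := by
  rw [overshoot_gt_eq_iUnion ξ hy, measure_iUnion, exitLaw, Measure.sum_apply _ measurableSet_Ioi]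
  · exact tsum_congr fun n => measure_first_passage h hξ n hy
  · intro m n hmn
    refine Set.disjoint_left.2 fun ω hm hn => hmn ?_
    have key : ∀ k, ω ∈ belowSet ξ k ∩ walk ξ (k + 1) ⁻¹' Ioi (1 + y) →
        passageTime ξ 1 ω = k + 1 := fun k hk =>
      (belowSet_inter_iff_passageTime_eq ξ k ω).1
        ⟨hk.1, le_of_lt (lt_of_le_of_lt (le_add_of_nonneg_right hy) hk.2)⟩
    have := (key m hm).symm.trans (key n hn)
    omega
  · exact fun n => (stepAlgebra_le hξ n _ (measurableSet_belowSet ξ n)).inter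
      (measurable_walk hξ (n + 1) measurableSet_Ioi)

theorem measurable_passageTime (hξ : ∀ i, Measurable (ξ i)) (r : ℝ) :
    Measurable (passageTime ξ r) := by
  have hS (n : ℕ) : MeasurableSet {ω | r ≤ walk ξ n ω} :=
    measurable_walk hξ n measurableSet_Ici
  refine measurable_to_countable' fun n => ?_
  by_cases hn : n = 0
  · have : passageTime ξ r ⁻¹' {n} =
        {ω | r ≤ walk ξ 0 ω} ∪ ⋂ k, {ω | r ≤ walk ξ k ω}ᶜ := by
      ext ω
      simp [passageTime, hn, Nat.sInf_eq_zero, eq_empty_iff_forall_notMem]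
    rw [this]
    exact (hS 0).union (MeasurableSet.iInter fun k => (hS k).compl)
  · have : passageTime ξ r ⁻¹' {n} =
        {ω | r ≤ walk ξ n ω} ∩ ⋂ k, ⋂ (_ : k < n), {ω | r ≤ walk ξ k ω}ᶜ := by
      ext ω
      simp only [mem_preimage, mem_singleton_iff, mem_inter_iff, mem_ofPred_eq, mem_iInter,
        mem_compl_iff]
      constructor
      · rintro rfl
        exact ⟨Nat.sInf_mem (Nat.nonempty_of_pos_sInf (Nat.pos_of_ne_zero hn)),
          fun k hk => Nat.notMem_of_lt_sInf hk⟩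
      · rintro ⟨h1, h2⟩
        refine le_antisymm (Nat.sInf_le h1) (le_csInf ⟨n, h1⟩ fun k hk => ?_)
        by_contra hlt
        exact h2 k (not_le.1 hlt) hk
    rw [this]
    exact (hS n).inter (MeasurableSet.iInter fun k => MeasurableSet.iInter fun _ => (hS k).compl)

theorem measurable_walkOvershoot (hξ : ∀ i, Measurable (ξ i)) (r : ℝ) :
    Measurable (walkOvershoot ξ r) := by
  have h : Measurable fun p : ℕ × Ω => walk ξ p.1 p.2 :=
    measurable_from_prod_countable_right fun n => measurable_walk hξ n
  exact (h.comp ((measurable_passageTime hξ r).prodMk measurable_id)).sub_const r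

theorem walkOvershoot_div {Ω : Type*} (ξ : ℕ → Ω → ℝ) {r : ℝ} (hr : 0 < r) (ω : Ω) :
    walkOvershoot (fun i ω => ξ i ω / r) 1 ω = walkOvershoot ξ r ω / r := by
  have hw (n : ℕ) : walk (fun i ω => ξ i ω / r) n ω = walk ξ n ω / r := by
    simp [walk, Finset.sum_div]
  have hp : passageTime (fun i ω => ξ i ω / r) 1 ω = passageTime ξ r ω := by
    simp only [passageTime, hw, one_le_div hr]
  rw [walkOvershoot, hp, hw, walkOvershoot]
  field_simp

theorem HasIndepSteps.comp (h : HasIndepSteps Q ξ F) {g : ℝ → ℝ} (hg : Measurable g) :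
    HasIndepSteps Q (fun i ω => g (ξ i ω)) (F.map g) := by
  intro n A B hA hB
  have hle : stepAlgebra (fun i ω => g (ξ i ω)) n ≤ stepAlgebra ξ n := by
    refine iSup₂_mono fun i _ => ?_
    change MeasurableSpace.comap (g ∘ ξ i) _ ≤ _
    rw [← MeasurableSpace.comap_comp]
    exact MeasurableSpace.comap_mono hg.comap_le
  rw [Measure.map_apply hg hB, ← h n A (g ⁻¹' B) (hle _ hA) (hg hB)]
  rfl

/-- A walk whose step law has a Laplace transform below `1` somewhere tends to `∞` in
probability, by Markov's inequality. -/
theorem HasIndepSteps.ae_exists_le_walk [IsProbabilityMeasure Q] [IsProbabilityMeasure F]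
    (h : HasIndepSteps Q ξ F) (hξ : ∀ i, Measurable (ξ i)) {u : ℝ} (hu : 0 < u)
    (hF : laplaceTransform F u < 1) (r : ℝ) : ∀ᵐ ω ∂Q, ∃ n, r ≤ walk ξ n ω := by
  have hb (n : ℕ) : Q {ω | ¬ ∃ n, r ≤ walk ξ n ω} ≤
      ENNReal.ofReal (Real.exp (u * r)) * laplaceTransform F u ^ n := by
    calc Q {ω | ¬ ∃ n, r ≤ walk ξ n ω} ≤ Q (walk ξ n ⁻¹' Iio r) := by
          refine measure_mono fun ω hω => ?_
          simp only [not_exists, not_le, mem_ofPred_eq] at hω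
          exact hω n
      _ = ∫⁻ x in Iio r, 1 ∂(convPow F n) := by
          rw [setLIntegral_one, ← h.map_walk hξ n, Measure.map_apply (measurable_walk hξ n)
            measurableSet_Iio]
      _ ≤ ∫⁻ x, ENNReal.ofReal (Real.exp (u * r)) * ENNReal.ofReal (Real.exp (-(u * x)))
            ∂(convPow F n) := by
          rw [← lintegral_indicator measurableSet_Iio]
          refine lintegral_mono fun x => ?_
          by_cases hx : x < r
          · rw [indicator_of_mem (by simpa using hx), ← ENNReal.ofReal_mul (Real.exp_nonneg _),
              ← Real.exp_add]
            refine ENNReal.one_le_ofReal.2 (Real.one_le_exp ?_)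
            nlinarith
          · rw [indicator_of_notMem (by simpa using hx)]
            exact zero_le
      _ = _ := by
          rw [lintegral_const_mul _ (by fun_prop), ← laplaceTransform_convPow]
          rfl
  have hlim : Tendsto (fun n => ENNReal.ofReal (Real.exp (u * r)) * laplaceTransform F u ^ n)
      atTop (𝓝 (ENNReal.ofReal (Real.exp (u * r)) * 0)) :=
    ENNReal.Tendsto.const_mul (ENNReal.tendsto_pow_atTop_nhds_zero_of_lt_one hF)
      (Or.inr ENNReal.ofReal_ne_top)
  rw [mul_zero] at hlim
  exact le_antisymm (ge_of_tendsto' hlim hb) zero_le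

end

/-! ### Convergence of Laplace transforms and vague convergence on the half-line -/

theorem integrable_exp_of_laplaceTransform_ne_top {μ : Measure ℝ} {u : ℝ}
    (h : laplaceTransform μ u ≠ ∞) : Integrable (fun x => Real.exp (-(u * x))) μ := by
  refine ⟨by fun_prop, ?_⟩
  rw [hasFiniteIntegral_iff_ofReal (ae_of_all _ fun x => Real.exp_nonneg _)]
  exact lt_top_iff_ne_top.2 h

theorem integral_exp_eq_toReal (μ : Measure ℝ) (u : ℝ) :
    ∫ x, Real.exp (-(u * x)) ∂μ = (laplaceTransform μ u).toReal :=
  integral_eq_lintegral_of_nonneg_ae (ae_of_all _ fun x => Real.exp_nonneg _) (by fun_prop)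

theorem integrable_of_laplaceTransform_ne_top {μ : Measure ℝ} (hμ : ∀ᵐ x ∂μ, 0 ≤ x)
    (h : laplaceTransform μ 1 ≠ ∞) {f : ℝ → ℝ} (hf : Continuous f) {K : ℝ}
    (hK : ∀ x, K ≤ x → f x = 0) : Integrable f μ := by
  obtain ⟨C, hC⟩ := (isCompact_Icc (a := (0 : ℝ)) (b := K)).exists_bound_of_continuousOn
    (f := fun x => f x * Real.exp x) (by fun_prop)
  refine ((integrable_exp_of_laplaceTransform_ne_top h).const_mul (max C 0)).mono'
    hf.aestronglyMeasurable ?_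
  filter_upwards [hμ] with x hx
  by_cases hxK : x ≤ K
  · have := hC x ⟨hx, hxK⟩
    rw [norm_mul, Real.norm_of_nonneg (Real.exp_nonneg x)] at this
    rw [one_mul, Real.exp_neg, ← div_eq_mul_inv, le_div_iff₀ (Real.exp_pos x)]
    exact this.trans (le_max_left _ _)
  · rw [hK x (by linarith), norm_zero]
    positivity

/-- A continuous function that vanishes near infinity is, relative to `exp (-x)`, uniformly close
on the half-line to a polynomial in `exp (-x)`. -/
theorem exists_polynomial_exp_near {f : ℝ → ℝ} (hf : Continuous f) {K : ℝ}
    (hK : ∀ x, K ≤ x → f x = 0) {ε : ℝ} (hε : 0 < ε) :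
    ∃ p : Polynomial ℝ, ∀ x, 0 ≤ x →
      |f x - Real.exp (-x) * p.eval (Real.exp (-x))| ≤ ε * Real.exp (-x) := by
  have hcont : Continuous fun t : ℝ => f (-Real.log (max t (Real.exp (-K)))) /
      max t (Real.exp (-K)) := by
    have hpos : ∀ t : ℝ, max t (Real.exp (-K)) ≠ 0 := fun t =>
      (lt_max_of_lt_right (Real.exp_pos _)).ne'
    exact (hf.comp ((continuous_id.max continuous_const).log hpos).neg).div
      (continuous_id.max continuous_const) hpos
  obtain ⟨p, hp⟩ := exists_polynomial_near_of_continuousOn 0 1 _ hcont.continuousOn ε hε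
  refine ⟨p, fun x hx => ?_⟩
  have hpx := hp (Real.exp (-x)) ⟨Real.exp_nonneg _, Real.exp_le_one_iff.2 (by linarith)⟩
  -- the extension used for the approximation agrees with `f x / exp (-x)`
  have heq : f (-Real.log (max (Real.exp (-x)) (Real.exp (-K)))) /
      max (Real.exp (-x)) (Real.exp (-K)) = f x / Real.exp (-x) := by
    by_cases hxK : x ≤ K
    · rw [max_eq_left (Real.exp_le_exp.2 (by linarith)), Real.log_exp, neg_neg]
    · rw [max_eq_right (Real.exp_le_exp.2 (by linarith)), Real.log_exp, neg_neg, hK K le_rfl,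
        hK x (by linarith), zero_div, zero_div]
  rw [heq] at hpx
  have h2 : f x - Real.exp (-x) * p.eval (Real.exp (-x)) =
      Real.exp (-x) * -(p.eval (Real.exp (-x)) - f x / Real.exp (-x)) := by
    field_simp
    ring
  rw [h2, abs_mul, abs_of_pos (Real.exp_pos _), abs_neg, mul_comm]
  exact mul_le_mul_of_nonneg_right hpx.le (Real.exp_nonneg _)

theorem exp_mul_eval_eq_sum (p : Polynomial ℝ) (x : ℝ) :
    Real.exp (-x) * p.eval (Real.exp (-x)) =
      ∑ k ∈ Finset.range (p.natDegree + 1), p.coeff k * Real.exp (-(((k : ℝ) + 1) * x)) := by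
  rw [Polynomial.eval_eq_sum_range, Finset.mul_sum]
  refine Finset.sum_congr rfl fun k _ => ?_
  rw [← Real.exp_nat_mul, mul_left_comm, ← Real.exp_add]
  ring_nf

theorem abs_integral_sub_le {μ : Measure ℝ} (hμ : ∀ᵐ x ∂μ, 0 ≤ x) {f : ℝ → ℝ} (hf : Continuous f)
    {K : ℝ} (hK : ∀ x, K ≤ x → f x = 0) {ε : ℝ} {p : Polynomial ℝ}
    (hp : ∀ x, 0 ≤ x → |f x - Real.exp (-x) * p.eval (Real.exp (-x))| ≤ ε * Real.exp (-x))
    (hfin : ∀ k ∈ Finset.range (p.natDegree + 1), laplaceTransform μ ((k : ℝ) + 1) ≠ ∞) :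
    |∫ x, f x ∂μ - ∑ k ∈ Finset.range (p.natDegree + 1),
      p.coeff k * (laplaceTransform μ ((k : ℝ) + 1)).toReal| ≤
        ε * (laplaceTransform μ 1).toReal := by
  have h1 : laplaceTransform μ 1 ≠ ∞ := by
    have := hfin 0 (by simp)
    simpa using this
  have hq : ∑ k ∈ Finset.range (p.natDegree + 1),
      p.coeff k * (laplaceTransform μ ((k : ℝ) + 1)).toReal =
      ∫ x, Real.exp (-x) * p.eval (Real.exp (-x)) ∂μ := by
    simp_rw [exp_mul_eval_eq_sum]
    rw [integral_finsetSum]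
    · refine Finset.sum_congr rfl fun k _ => ?_
      rw [integral_const_mul, integral_exp_eq_toReal]
    · exact fun k hk => (integrable_exp_of_laplaceTransform_ne_top (hfin k hk)).const_mul _
  have hqi : Integrable (fun x => Real.exp (-x) * p.eval (Real.exp (-x))) μ := by
    simp_rw [exp_mul_eval_eq_sum]
    exact integrable_finsetSum _ fun k hk =>
      (integrable_exp_of_laplaceTransform_ne_top (hfin k hk)).const_mul _
  rw [hq, ← integral_sub (integrable_of_laplaceTransform_ne_top hμ h1 hf hK) hqi,
    ← integral_exp_eq_toReal, ← integral_const_mul, ← Real.norm_eq_abs]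
  refine norm_integral_le_of_norm_le
    ((integrable_exp_of_laplaceTransform_ne_top h1).const_mul _) ?_
  filter_upwards [hμ] with x hx
  rw [one_mul]
  exact hp x hx

section

variable {ι : Type*} {l : Filter ι} {μ : ι → Measure ℝ} {ν : Measure ℝ}

/-- **Continuity theorem for Laplace transforms**: convergence of the Laplace transforms implies
convergence of the integrals of continuous functions that vanish near infinity. -/
theorem tendsto_integral_of_tendsto_laplaceTransform
    (hμ : ∀ i, ∀ᵐ x ∂(μ i), 0 ≤ x) (hν : ∀ᵐ x ∂ν, 0 ≤ x)
    (hfin : ∀ u, 0 < u → laplaceTransform ν u ≠ ∞)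
    (hL : ∀ u, 0 < u → Tendsto (fun i => laplaceTransform (μ i) u) l (𝓝 (laplaceTransform ν u)))
    {f : ℝ → ℝ} (hf : Continuous f) {K : ℝ} (hK : ∀ x, K ≤ x → f x = 0) :
    Tendsto (fun i => ∫ x, f x ∂(μ i)) l (𝓝 (∫ x, f x ∂ν)) := by
  rw [Metric.tendsto_nhds]
  intro δ hδ
  have hLr (u : ℝ) (hu : 0 < u) : Tendsto (fun i => (laplaceTransform (μ i) u).toReal) l
      (𝓝 (laplaceTransform ν u).toReal) := (ENNReal.tendsto_toReal (hfin u hu)).comp (hL u hu)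
  set B : ℝ := (laplaceTransform ν 1).toReal + 1 with hB
  have hBpos : 0 < B := by positivity
  obtain ⟨p, hp⟩ := exists_polynomial_exp_near hf hK (ε := δ / (4 * B)) (by positivity)
  have hev1 : ∀ᶠ i in l, ∀ k ∈ Finset.range (p.natDegree + 1),
      laplaceTransform (μ i) ((k : ℝ) + 1) ≠ ∞ := by
    rw [Filter.eventually_all_finset]
    intro k _
    exact (hL _ (by positivity)).eventually_ne (hfin _ (by positivity))
  have hev2 : ∀ᶠ i in l, (laplaceTransform (μ i) 1).toReal < B :=
    (hLr 1 one_pos).eventually_lt_const (by linarith)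
  have hsum : Tendsto (fun i => ∑ k ∈ Finset.range (p.natDegree + 1),
      p.coeff k * (laplaceTransform (μ i) ((k : ℝ) + 1)).toReal) l
      (𝓝 (∑ k ∈ Finset.range (p.natDegree + 1),
        p.coeff k * (laplaceTransform ν ((k : ℝ) + 1)).toReal)) :=
    tendsto_finsetSum _ fun k _ => (hLr _ (by positivity)).const_mul _
  have hev3 := (Metric.tendsto_nhds.1 hsum) (δ / 2) (by positivity)
  filter_upwards [hev1, hev2, hev3] with i h1 h2 h3
  have e1 := abs_integral_sub_le (hμ i) hf hK hp h1
  have e2 := abs_integral_sub_le hν hf hK hp fun k _ => hfin _ (by positivity)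
  have e1' : δ / (4 * B) * (laplaceTransform (μ i) 1).toReal ≤ δ / 4 := by
    calc _ ≤ δ / (4 * B) * B := by gcongr
      _ = δ / 4 := by field_simp
  have e2' : δ / (4 * B) * (laplaceTransform ν 1).toReal < δ / 4 := by
    calc _ < δ / (4 * B) * B := by gcongr; linarith
      _ = δ / 4 := by field_simp
  rw [Real.dist_eq] at h3 ⊢
  rw [abs_le] at e1 e2
  rw [abs_lt] at h3 ⊢
  constructor <;> linarith [e1.1, e1.2, e2.1, e2.2, h3.1, h3.2]

/-- A continuous function that is `1` on `(-∞, a]` and `0` on `[a + 1 / s, ∞)`. -/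
noncomputable def ramp (s a x : ℝ) : ℝ := max 0 (min 1 (1 - s * (x - a)))

theorem continuous_ramp (s a : ℝ) : Continuous (ramp s a) := by unfold ramp; fun_prop

theorem ramp_nonneg (s a x : ℝ) : 0 ≤ ramp s a x := le_max_left _ _

theorem ramp_le_one (s a x : ℝ) : ramp s a x ≤ 1 := max_le zero_le_one (min_le_left _ _)

theorem ramp_eq_one {s a x : ℝ} (hs : 0 ≤ s) (hx : x ≤ a) : ramp s a x = 1 := by
  have : s * (x - a) ≤ 0 := mul_nonpos_of_nonneg_of_nonpos hs (by linarith)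
  rw [ramp, min_eq_left (by linarith), max_eq_right zero_le_one]

theorem ramp_eq_zero {s a x : ℝ} (hs : 1 ≤ s * (x - a)) : ramp s a x = 0 := by
  rw [ramp, max_eq_left ((min_le_right _ _).trans (by linarith))]

/-- The test function may be cut off at a point that the limit measure does not charge. -/
theorem tendsto_setIntegral_Iio_of_tendsto_laplaceTransform
    (hμ : ∀ i, ∀ᵐ x ∂(μ i), 0 ≤ x) (hν : ∀ᵐ x ∂ν, 0 ≤ x)
    (hfin : ∀ u, 0 < u → laplaceTransform ν u ≠ ∞)
    (hL : ∀ u, 0 < u → Tendsto (fun i => laplaceTransform (μ i) u) l (𝓝 (laplaceTransform ν u)))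
    {g : ℝ → ℝ} (hg : Continuous g) (hg0 : ∀ x, 0 ≤ g x) {c : ℝ} (hc : ν {c} = 0) :
    Tendsto (fun i => ∫ x in Iio c, g x ∂(μ i)) l (𝓝 (∫ x in Iio c, g x ∂ν)) := by
  have hs0 (n : ℕ) : (0 : ℝ) < (n : ℝ) + 1 := by positivity
  -- continuous approximations of the cut-off function from above and from below
  set hi : ℕ → ℝ → ℝ := fun n x => g x * ramp ((n : ℝ) + 1) c x with hhi
  set lo : ℕ → ℝ → ℝ := fun n x => g x * ramp ((n : ℝ) + 1) (c - 1 / ((n : ℝ) + 1)) x with hlo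
  have hic (n : ℕ) : Continuous (hi n) := hg.mul (continuous_ramp _ _)
  have loc (n : ℕ) : Continuous (lo n) := hg.mul (continuous_ramp _ _)
  have hiK (n : ℕ) (x : ℝ) (hx : c + 1 ≤ x) : hi n x = 0 := by
    simp only [hhi]
    rw [ramp_eq_zero, mul_zero]
    nlinarith [(Nat.cast_nonneg n : (0 : ℝ) ≤ n)]
  have lo0 (n : ℕ) (x : ℝ) (hx : c ≤ x) : lo n x = 0 := by
    simp only [hlo]
    rw [ramp_eq_zero, mul_zero]
    calc (1 : ℝ) = ((n : ℝ) + 1) * (1 / ((n : ℝ) + 1)) := by field_simp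
      _ ≤ _ := by gcongr; linarith
  have lo_le (n : ℕ) (x : ℝ) : lo n x ≤ (Iio c).indicator g x := by
    by_cases hx : x < c
    · rw [indicator_of_mem (by simpa using hx)]
      exact mul_le_of_le_one_right (hg0 x) (ramp_le_one _ _ _)
    · rw [indicator_of_notMem (by simpa using hx), lo0 n x (not_lt.1 hx)]
  have le_hi (n : ℕ) (x : ℝ) : (Iio c).indicator g x ≤ hi n x := by
    by_cases hx : x < c
    · rw [indicator_of_mem (by simpa using hx)]
      simp only [hhi]
      rw [ramp_eq_one (hs0 n).le hx.le, mul_one]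
    · rw [indicator_of_notMem (by simpa using hx)]
      exact mul_nonneg (hg0 x) (ramp_nonneg _ _ _)
  have hi_le (n : ℕ) (x : ℝ) : hi n x ≤ hi 0 x := by
    by_cases hx : x < c
    · simp only [hhi]
      rw [ramp_eq_one (hs0 n).le hx.le, ramp_eq_one (hs0 0).le hx.le]
    · refine mul_le_mul_of_nonneg_left ?_ (hg0 x)
      unfold ramp
      have h1 : 0 ≤ x - c := by linarith
      have h2 : (((0 : ℕ) : ℝ) + 1) * (x - c) ≤ ((n : ℝ) + 1) * (x - c) := by gcongr; simp
      gcongr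
  have hind (m : Measure ℝ) (hm : ∀ᵐ x ∂m, 0 ≤ x) (h1 : laplaceTransform m 1 ≠ ∞) :
      Integrable ((Iio c).indicator g) m :=
    (integrable_of_laplaceTransform_ne_top hm h1 (hic 0) (hiK 0)).mono'
      (hg.aestronglyMeasurable.indicator measurableSet_Iio) (ae_of_all _ fun x => by
        rw [Real.norm_of_nonneg (indicator_nonneg (fun x _ => hg0 x) x)]
        exact le_hi 0 x)
  have hν1 := hfin 1 one_pos
  have hi0i := integrable_of_laplaceTransform_ne_top hν hν1 (hic 0) (hiK 0)
  have hae : ∀ᵐ x ∂ν, x ≠ c := measure_eq_zero_iff_ae_notMem.1 hc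
  have htend : Tendsto (fun n : ℕ => (n : ℝ) + 1) atTop atTop :=
    tendsto_natCast_atTop_atTop.atTop_add tendsto_const_nhds
  have hinv : Tendsto (fun n : ℕ => 1 / ((n : ℝ) + 1)) atTop (𝓝 0) :=
    tendsto_one_div_add_atTop_nhds_zero_nat
  have hhilim : Tendsto (fun n => ∫ x, hi n x ∂ν) atTop
      (𝓝 (∫ x, (Iio c).indicator g x ∂ν)) := by
    refine tendsto_integral_of_dominated_convergence (hi 0)
      (fun n => (hic n).aestronglyMeasurable) hi0i (fun n => ae_of_all _ fun x => ?_) ?_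
    · rw [Real.norm_of_nonneg (mul_nonneg (hg0 x) (ramp_nonneg _ _ _))]
      exact hi_le n x
    · filter_upwards [hae] with x hx
      refine tendsto_const_nhds.congr' ?_
      rcases lt_or_gt_of_ne hx with hx | hx
      · filter_upwards with n
        rw [indicator_of_mem (by simpa using hx)]
        simp only [hhi]
        rw [ramp_eq_one (hs0 n).le hx.le, mul_one]
      · have : Tendsto (fun n : ℕ => ((n : ℝ) + 1) * (x - c)) atTop atTop :=
          htend.atTop_mul_const (by linarith)
        filter_upwards [this.eventually_ge_atTop 1] with n hn
        rw [indicator_of_notMem (by simpa using hx.le)]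
        simp only [hhi]
        rw [ramp_eq_zero hn, mul_zero]
  have hlolim : Tendsto (fun n => ∫ x, lo n x ∂ν) atTop
      (𝓝 (∫ x, (Iio c).indicator g x ∂ν)) := by
    refine tendsto_integral_of_dominated_convergence (hi 0)
      (fun n => (loc n).aestronglyMeasurable) hi0i (fun n => ae_of_all _ fun x => ?_) ?_
    · rw [Real.norm_of_nonneg (mul_nonneg (hg0 x) (ramp_nonneg _ _ _))]
      exact (lo_le n x).trans (le_hi 0 x)
    · refine ae_of_all _ fun x => tendsto_const_nhds.congr' ?_
      by_cases hx : x < c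
      · filter_upwards [hinv.eventually_lt_const (sub_pos.2 hx)] with n hn
        rw [indicator_of_mem (by simpa using hx)]
        simp only [hlo]
        rw [ramp_eq_one (hs0 n).le (by linarith), mul_one]
      · filter_upwards with n
        rw [indicator_of_notMem (by simpa using hx), lo0 n x (not_lt.1 hx)]
  have hμ1 : ∀ᶠ i in l, laplaceTransform (μ i) 1 ≠ ∞ := (hL 1 one_pos).eventually_ne hν1
  simp_rw [← integral_indicator measurableSet_Iio]
  refine tendsto_order.2 ⟨fun a ha => ?_, fun a ha => ?_⟩
  · obtain ⟨n, hn⟩ := (hlolim.eventually_const_lt ha).exists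
    have := tendsto_integral_of_tendsto_laplaceTransform hμ hν hfin hL (loc n) (lo0 n)
    filter_upwards [this.eventually_const_lt hn, hμ1] with i h1 h2
    exact h1.trans_le (integral_mono
      (integrable_of_laplaceTransform_ne_top (hμ i) h2 (loc n) (lo0 n)) (hind _ (hμ i) h2)
      (lo_le n))
  · obtain ⟨n, hn⟩ := (hhilim.eventually_lt_const ha).exists
    have := tendsto_integral_of_tendsto_laplaceTransform hμ hν hfin hL (hic n) (hiK n)
    filter_upwards [this.eventually_lt_const hn, hμ1] with i h1 h2
    exact (integral_mono (hind _ (hμ i) h2)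
      (integrable_of_laplaceTransform_ne_top (hμ i) h2 (hic n) (hiK n)) (le_hi n)).trans_lt h1

end

/-! ### Power densities and the generalized arcsine law -/

/-- The measure `c x ^ (s - 1) dx` on `(0, ∞)`. -/
noncomputable def powerMeasure (c s : ℝ) : Measure ℝ :=
  (volume.restrict (Ioi 0)).withDensity fun x => ENNReal.ofReal (c * x ^ (s - 1))

theorem ae_nonneg_powerMeasure (c s : ℝ) : ∀ᵐ x ∂(powerMeasure c s), 0 ≤ x := by
  refine (withDensity_absolutelyContinuous _ _).ae_le ?_
  filter_upwards [ae_restrict_mem measurableSet_Ioi] with x hx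
  exact le_of_lt hx

theorem powerMeasure_singleton (c s a : ℝ) : powerMeasure c s {a} = 0 :=
  withDensity_absolutelyContinuous _ _ (Measure.restrict_le_self.absolutelyContinuous (by simp))

theorem lintegral_powerMeasure (c s : ℝ) {f : ℝ → ℝ≥0∞} (hf : Measurable f) :
    ∫⁻ x, f x ∂(powerMeasure c s) = ∫⁻ x in Ioi 0, ENNReal.ofReal (c * x ^ (s - 1)) * f x := by
  rw [powerMeasure, lintegral_withDensity_eq_lintegral_mul _ (by fun_prop) hf]
  rfl

theorem laplaceTransform_powerMeasure {c s : ℝ} (hc : 0 ≤ c) (hs : 0 < s) {u : ℝ} (hu : 0 < u) :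
    laplaceTransform (powerMeasure c s) u =
      ENNReal.ofReal (c * ((1 / u) ^ s * Real.Gamma s)) := by
  rw [laplaceTransform, lintegral_powerMeasure _ _ (by fun_prop),
    ← Real.integral_rpow_mul_exp_neg_mul_Ioi hs hu, ← integral_const_mul,
    ofReal_integral_eq_lintegral_ofReal]
  · refine setLIntegral_congr_fun measurableSet_Ioi fun x hx => ?_
    have hx' : 0 < x := hx
    rw [← ENNReal.ofReal_mul (by positivity), mul_assoc]
  · have h := Real.integral_rpow_mul_exp_neg_mul_Ioi hs hu
    refine Integrable.const_mul ?_ c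
    -- a function with nonzero integral is integrable
    by_contra hni
    rw [integral_undef hni] at h
    have : 0 < (1 / u) ^ s * Real.Gamma s :=
      mul_pos (Real.rpow_pos_of_pos (by positivity) _) (Real.Gamma_pos_of_pos hs)
    linarith
  · filter_upwards [ae_restrict_mem measurableSet_Ioi] with x hx
    have hx' : 0 < x := hx
    simp only [Pi.zero_apply]
    positivity

theorem lintegral_Ioi_rpow {α : ℝ} (hα : 0 < α) {b : ℝ} (hb : 0 < b) :
    ∫⁻ z in Ioi b, ENNReal.ofReal (α * z ^ (-α - 1)) = ENNReal.ofReal (b ^ (-α)) := by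
  rw [← ofReal_integral_eq_lintegral_ofReal, integral_const_mul,
    integral_Ioi_rpow_of_lt (by linarith) hb]
  · congr 1
    have : -α - 1 + 1 = -α := by ring
    rw [this]
    field_simp
  · exact (integrableOn_Ioi_rpow_of_lt (by linarith) hb).const_mul _
  · filter_upwards [ae_restrict_mem measurableSet_Ioi] with x hx
    have hx' : 0 < x := hb.trans hx
    simp only [Pi.zero_apply]
    positivity

theorem lintegral_tail_shift {α : ℝ} (hα : 0 < α) {x y : ℝ} (hx : x < 1) (hy : 0 ≤ y) :
    ∫⁻ z in Ioi y, ENNReal.ofReal (α * (1 + z - x) ^ (-α - 1)) =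
      ENNReal.ofReal ((1 + y - x) ^ (-α)) := by
  rw [← lintegral_Ioi_rpow hα (b := 1 + y - x) (by linarith),
    ← lintegral_indicator measurableSet_Ioi, ← lintegral_indicator measurableSet_Ioi,
    ← lintegral_add_right_eq_self ((Ioi (1 + y - x)).indicator _) (1 - x)]
  refine lintegral_congr fun z => ?_
  have h1 : z + (1 - x) = 1 + z - x := by ring
  by_cases hz : y < z
  · rw [indicator_of_mem (by simpa using hz), indicator_of_mem (by simp only [mem_Ioi]; linarith),
      h1]
  · rw [indicator_of_notMem (by simpa using hz),
      indicator_of_notMem (by simp only [mem_Ioi]; linarith)]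

/-- The antiderivative of `α x ^ (α - 1) (a - x) ^ (-α - 1)` is `(x / (a - x)) ^ α / a`. -/
theorem hasDerivAt_rpow_div {α a x : ℝ} (hx : 0 < x) (hxa : x < a) :
    HasDerivAt (fun x => a⁻¹ * (x / (a - x)) ^ α)
      (α * x ^ (α - 1) * (a - x) ^ (-α - 1)) x := by
  have h1 : 0 < a - x := by linarith
  have ha : 0 < a := by linarith
  have hd : HasDerivAt (fun x => x / (a - x)) (a / (a - x) ^ 2) x := by
    have := (hasDerivAt_id x).div ((hasDerivAt_id x).const_sub a) h1.ne'
    convert! this using 1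
    simp only [id]
    ring
  have hr := (hd.rpow_const (p := α) (Or.inl (div_pos hx h1).ne')).const_mul a⁻¹
  convert! hr using 1
  rw [Real.div_rpow hx.le h1.le]
  have e1 : (a - x) ^ (-α - 1) = ((a - x) ^ (α - 1) * (a - x) ^ 2)⁻¹ := by
    rw [← Real.rpow_natCast, ← Real.rpow_add h1, ← Real.rpow_neg h1.le]
    congr 1
    push_cast
    ring
  rw [e1]
  have : (a - x) ^ (α - 1) ≠ 0 := (Real.rpow_pos_of_pos h1 _).ne'
  field_simp

theorem lintegral_Ioo_rpow_mul {α : ℝ} (hα : 0 < α) {z : ℝ} (hz : 0 < z) :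
    ∫⁻ x in Ioo 0 1, ENNReal.ofReal (α * x ^ (α - 1) * (1 + z - x) ^ (-α - 1)) =
      ENNReal.ofReal (z ^ (-α) * (1 + z)⁻¹) := by
  have hcont : ContinuousOn (fun x => (1 + z)⁻¹ * (x / (1 + z - x)) ^ α) (Icc 0 1) := by
    refine continuousOn_const.mul (ContinuousOn.rpow_const ?_ fun x _ => Or.inr hα.le)
    refine continuousOn_id.div (by fun_prop) fun x hx => ?_
    have := hx.2
    linarith
  have hderiv : ∀ x ∈ Ioo (0 : ℝ) 1, HasDerivAt (fun x => (1 + z)⁻¹ * (x / (1 + z - x)) ^ α)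
      (α * x ^ (α - 1) * (1 + z - x) ^ (-α - 1)) x := fun x hx =>
    hasDerivAt_rpow_div hx.1 (by linarith [hx.2])
  have hpos : ∀ x ∈ Ioo (0 : ℝ) 1, 0 ≤ α * x ^ (α - 1) * (1 + z - x) ^ (-α - 1) := fun x hx => by
    have h1 := hx.1
    have h2 : 0 < 1 + z - x := by linarith [hx.2]
    positivity
  have hint : IntegrableOn (fun x => α * x ^ (α - 1) * (1 + z - x) ^ (-α - 1)) (Ioc 0 1) :=
    intervalIntegral.integrableOn_deriv_of_nonneg hcont hderiv hpos
  have hI := intervalIntegral.integral_eq_sub_of_hasDerivAt_of_le zero_le_one hcont hderiv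
    ((intervalIntegrable_iff_integrableOn_Ioc_of_le zero_le_one).2 hint)
  rw [intervalIntegral.integral_of_le zero_le_one, integral_Ioc_eq_integral_Ioo] at hI
  rw [← ofReal_integral_eq_lintegral_ofReal (hint.mono_set Ioo_subset_Ioc_self), hI]
  · congr 1
    have h0 : 1 + z - 1 = z := by ring
    rw [zero_div, Real.zero_rpow hα.ne', mul_zero, sub_zero, h0, one_div, Real.inv_rpow hz.le,
      Real.rpow_neg hz.le, mul_comm]
  · filter_upwards [ae_restrict_mem measurableSet_Ioo] with x hx
    exact hpos x hx

theorem sin_div_pi_pos {α : ℝ} (hα₀ : 0 < α) (hα₁ : α < 1) :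
    0 < Real.sin (Real.pi * α) / Real.pi :=
  div_pos (Real.sin_pos_of_pos_of_lt_pi (by positivity) (by nlinarith [Real.pi_pos])) Real.pi_pos

/-- The tail of the limit law, as the integral of the tail `x ^ (-α)` of the Lévy measure against
the potential density `(sin πα / π) x ^ (α - 1)`. -/
theorem dynkinLaw_Ioi {α : ℝ} (hα₀ : 0 < α) (hα₁ : α < 1) {y : ℝ} (hy : 0 ≤ y) :
    dynkinLaw α (Ioi y) = ∫⁻ x in Ioo 0 1,
      ENNReal.ofReal (Real.sin (Real.pi * α) / Real.pi * x ^ (α - 1)) *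
        ENNReal.ofReal ((1 + y - x) ^ (-α)) := by
  set c := Real.sin (Real.pi * α) / Real.pi with hc
  have hc0 : 0 < c := sin_div_pi_pos hα₀ hα₁
  symm
  calc ∫⁻ x in Ioo 0 1, ENNReal.ofReal (c * x ^ (α - 1)) * ENNReal.ofReal ((1 + y - x) ^ (-α))
      = ∫⁻ x in Ioo 0 1, ∫⁻ z in Ioi y, ENNReal.ofReal (c * x ^ (α - 1)) *
          ENNReal.ofReal (α * (1 + z - x) ^ (-α - 1)) := by
        refine setLIntegral_congr_fun measurableSet_Ioo fun x hx => ?_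
        rw [lintegral_const_mul _ (by fun_prop), lintegral_tail_shift hα₀ hx.2 hy]
    _ = ∫⁻ z in Ioi y, ∫⁻ x in Ioo 0 1, ENNReal.ofReal (c * x ^ (α - 1)) *
          ENNReal.ofReal (α * (1 + z - x) ^ (-α - 1)) :=
        lintegral_lintegral_swap (by fun_prop)
    _ = ∫⁻ z in Ioi y, ENNReal.ofReal (c * z ^ (-α) * (1 + z)⁻¹) := by
        refine setLIntegral_congr_fun measurableSet_Ioi fun z hz => ?_
        have hz0 : 0 < z := lt_of_le_of_lt hy hz
        rw [mul_assoc, ENNReal.ofReal_mul hc0.le, ← lintegral_Ioo_rpow_mul hα₀ hz0,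
          ← lintegral_const_mul _ (by fun_prop)]
        refine setLIntegral_congr_fun measurableSet_Ioo fun x hx => ?_
        have h1 := hx.1
        have h2 : 0 < 1 + z - x := by linarith [hx.2]
        rw [← ENNReal.ofReal_mul (by positivity), ← ENNReal.ofReal_mul hc0.le]
        ring_nf
    _ = dynkinLaw α (Ioi y) := by
        rw [dynkinLaw, withDensity_apply _ measurableSet_Ioi,
          Measure.restrict_restrict measurableSet_Ioi, Ioi_inter_Ioi, max_eq_left hy]

theorem dynkinLaw_Ioi_zero {α : ℝ} (hα₀ : 0 < α) (hα₁ : α < 1) : dynkinLaw α (Ioi 0) = 1 := by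
  rw [dynkinLaw_Ioi hα₀ hα₁ le_rfl, ← lintegral_betaPDF_eq_one hα₀ (sub_pos.2 hα₁),
    lintegral_betaPDF]
  refine setLIntegral_congr_fun measurableSet_Ioo fun x hx => ?_
  have hb : 1 / beta α (1 - α) = Real.sin (Real.pi * α) / Real.pi := by
    rw [beta, Real.Gamma_mul_Gamma_one_sub]
    simp
  have h1 := hx.1
  have := sin_div_pi_pos hα₀ hα₁
  rw [← ENNReal.ofReal_mul (by positivity), hb]
  congr 3 <;> ring

theorem dynkinLaw_Iic_zero (α : ℝ) : dynkinLaw α (Iic 0) = 0 :=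
  withDensity_absolutelyContinuous _ _ (by
    rw [Measure.restrict_apply measurableSet_Iic, Iic_inter_Ioi, Ioc_self, measure_empty])

theorem isProbabilityMeasure_dynkinLaw {α : ℝ} (hα₀ : 0 < α) (hα₁ : α < 1) :
    IsProbabilityMeasure (dynkinLaw α) := by
  refine ⟨?_⟩
  rw [← Iic_union_Ioi (a := (0 : ℝ)), measure_union (Iic_disjoint_Ioi le_rfl) measurableSet_Ioi,
    dynkinLaw_Iic_zero, dynkinLaw_Ioi_zero hα₀ hα₁, zero_add]

/-! ### The overshoot in the limit of a family of walks -/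

section

variable {ι : Type*} {l : Filter ι}

/-- Pointwise convergence of antitone functions to a continuous function is locally uniform. -/
theorem tendstoUniformlyOn_of_antitone {f : ι → ℝ → ℝ} {g : ℝ → ℝ}
    (hf : ∀ᶠ i in l, Antitone (f i)) (hg : ContinuousOn g (Ioi 0))
    (hlim : ∀ z, 0 < z → Tendsto (fun i => f i z) l (𝓝 (g z))) {a b : ℝ} (ha : 0 < a) :
    TendstoUniformlyOn f g l (Icc a b) := by
  rw [← tendstoLocallyUniformlyOn_iff_tendstoUniformlyOn_of_compact isCompact_Icc,
    Metric.tendstoLocallyUniformlyOn_iff]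
  intro ε hε z hz
  have hz0 : 0 < z := ha.trans_le hz.1
  have hcont := (hg.continuousAt (Ioi_mem_nhds hz0))
  obtain ⟨δ, hδ, hgδ⟩ := Metric.continuousAt_iff.1 hcont (ε / 4) (by positivity)
  set η := min (δ / 2) (z / 2) with hη
  have hη0 : 0 < η := lt_min (by positivity) (by positivity)
  have hηδ : η < δ := (min_le_left _ _).trans_lt (by linarith)
  have hηz : η < z := (min_le_right _ _).trans_lt (by linarith)
  have hclose : ∀ x, |x - z| ≤ η → |g x - g z| < ε / 4 := fun x hx => by
    have := hgδ (x := x) (by rw [Real.dist_eq]; linarith)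
    rwa [Real.dist_eq] at this
  refine ⟨Icc (z - η) (z + η), mem_nhdsWithin_of_mem_nhds (Icc_mem_nhds (by linarith)
    (by linarith)), ?_⟩
  have e1 := (Metric.tendsto_nhds.1 (hlim (z - η) (by linarith))) (ε / 4) (by positivity)
  have e2 := (Metric.tendsto_nhds.1 (hlim (z + η) (by linarith))) (ε / 4) (by positivity)
  filter_upwards [e1, e2, hf] with i h1 h2 hi x hx
  have g1 := abs_lt.1 (hclose (z - η) (by rw [sub_sub_cancel_left, abs_neg, abs_of_pos hη0]))
  have g2 := abs_lt.1 (hclose (z + η) (by rw [add_sub_cancel_left, abs_of_pos hη0]))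
  have g3 := abs_lt.1 (hclose x (abs_le.2 ⟨by linarith [hx.1], by linarith [hx.2]⟩))
  rw [Real.dist_eq] at h1 h2 ⊢
  have m1 := hi hx.1
  have m2 := hi hx.2
  rw [abs_lt] at h1 h2 ⊢
  constructor <;> linarith [h1.1, h1.2, h2.1, h2.2, g1.1, g1.2, g2.1, g2.2, g3.1, g3.2]

theorem tendsto_of_forall_eventually_le_add {p G : ι → ℝ≥0∞} {g : ℝ≥0∞} (hg : g ≠ ∞)
    (hG : Tendsto G l (𝓝 g))
    (h : ∀ δ : ℝ≥0∞, 0 < δ → ∀ᶠ i in l, p i ≤ G i + δ ∧ G i ≤ p i + δ) :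
    Tendsto p l (𝓝 g) := by
  rw [ENNReal.tendsto_nhds hg] at hG ⊢
  intro ε hε
  have hε2 : 0 < ε / 2 := ENNReal.half_pos hε.ne'
  filter_upwards [hG _ hε2, h _ hε2] with i h1 h2
  constructor
  · rw [tsub_le_iff_right]
    calc g ≤ G i + ε / 2 := tsub_le_iff_right.1 h1.1
      _ ≤ p i + ε / 2 + ε / 2 := by gcongr; exact h2.2
      _ = p i + ε := by rw [add_assoc, ENNReal.add_halves]
  · calc p i ≤ G i + ε / 2 := h2.1
      _ ≤ g + ε / 2 + ε / 2 := by gcongr; exact h1.2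
      _ = g + ε := by rw [add_assoc, ENNReal.add_halves]

variable {F : ι → Measure ℝ} [hF : ∀ i, IsProbabilityMeasure (F i)] {a : ι → ℝ} {α : ℝ}

/-- The renewal measure on the half-line `[0, ∞)`, multiplied by `a`. -/
noncomputable def scaledRenewal (F : Measure ℝ) (a : ℝ) : Measure ℝ :=
  ENNReal.ofReal a • (renewalMeasure F).restrict (Ici 0)

theorem ae_nonneg_scaledRenewal (F : Measure ℝ) (a : ℝ) : ∀ᵐ x ∂(scaledRenewal F a), 0 ≤ x :=
  Measure.smul_absolutelyContinuous.ae_le (ae_restrict_mem measurableSet_Ici)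

/-- Contributions of the negative half-line being negligible, the Laplace transform of the scaled
renewal measure converges to that of the potential measure of the stable subordinator. -/
theorem tendsto_laplaceTransform_scaledRenewal (hα₀ : 0 < α) (hα₁ : α < 1)
    (hU : ∀ u, 0 < u → Tendsto (fun i => ENNReal.ofReal (a i) *
      (1 - laplaceTransform (F i) u)⁻¹) l
        (𝓝 (ENNReal.ofReal ((1 / u) ^ α * (Real.Gamma (1 - α))⁻¹))))
    (hneg : ∀ u, 0 < u → Tendsto (fun i => ENNReal.ofReal (a i) *
      ∫⁻ x in Iio 0, ENNReal.ofReal (Real.exp (-(u * x))) ∂(renewalMeasure (F i))) l (𝓝 0))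
    {u : ℝ} (hu : 0 < u) :
    Tendsto (fun i => laplaceTransform (scaledRenewal (F i) (a i)) u) l
      (𝓝 (laplaceTransform (powerMeasure (Real.sin (Real.pi * α) / Real.pi) α) u)) := by
  have hval : laplaceTransform (powerMeasure (Real.sin (Real.pi * α) / Real.pi) α) u =
      ENNReal.ofReal ((1 / u) ^ α * (Real.Gamma (1 - α))⁻¹) := by
    rw [laplaceTransform_powerMeasure (sin_div_pi_pos hα₀ hα₁).le hα₀ hu]
    congr 1
    have h1 := Real.Gamma_mul_Gamma_one_sub α
    have h2 : Real.Gamma (1 - α) ≠ 0 := (Real.Gamma_pos_of_pos (by linarith)).ne'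
    have h3 : Real.sin (Real.pi * α) / Real.pi = (Real.Gamma α * Real.Gamma (1 - α))⁻¹ := by
      rw [h1, inv_div]
    have h4 : Real.Gamma α ≠ 0 := (Real.Gamma_pos_of_pos hα₀).ne'
    rw [h3]
    field_simp
  rw [hval]
  have hsub := ENNReal.Tendsto.sub (hU u hu) (hneg u hu) (Or.inl ENNReal.ofReal_ne_top)
  rw [tsub_zero] at hsub
  refine hsub.congr' ?_
  filter_upwards [(hneg u hu).eventually_ne (b₂ := ∞) (by simp)] with i hi
  symm
  refine ENNReal.eq_sub_of_add_eq hi ?_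
  rw [scaledRenewal, laplaceTransform, lintegral_smul_measure, smul_eq_mul, ← mul_add,
    ← laplaceTransform_renewalMeasure, laplaceTransform, ← compl_Ici, lintegral_add_compl _
      measurableSet_Ici]

/-- **Dynkin–Lamperti theorem** for a family of walks: if the tails of the step laws are
asymptotic to `a i * z ^ (-α)`, the renewal measures are of order `1 / a i` with the Laplace
transforms of the stable potential measure, and negative values contribute negligibly, then the
overshoot over level `1` converges to the generalized arcsine law. -/
theorem tendsto_exitLaw_Ioi (hα₀ : 0 < α) (hα₁ : α < 1)
    (hapos : ∀ᶠ i in l, 0 < a i)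
    (htail : ∀ z, 0 < z → Tendsto (fun i => (F i).real (Ioi z) / a i) l (𝓝 (z ^ (-α))))
    (hU : ∀ u, 0 < u → Tendsto (fun i => ENNReal.ofReal (a i) *
      (1 - laplaceTransform (F i) u)⁻¹) l
        (𝓝 (ENNReal.ofReal ((1 / u) ^ α * (Real.Gamma (1 - α))⁻¹))))
    (hneg : ∀ u, 0 < u → Tendsto (fun i => ENNReal.ofReal (a i) *
      ∫⁻ x in Iio 0, ENNReal.ofReal (Real.exp (-(u * x))) ∂(renewalMeasure (F i))) l (𝓝 0))
    {y : ℝ} (hy : 0 < y) :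
    Tendsto (fun i => exitLaw (F i) (Ioi (1 + y))) l (𝓝 (dynkinLaw α (Ioi y))) := by
  set c := Real.sin (Real.pi * α) / Real.pi with hc
  have hc0 : 0 < c := sin_div_pi_pos hα₀ hα₁
  have := isProbabilityMeasure_dynkinLaw hα₀ hα₁
  -- the tail `(1 + y - x) ^ (-α)`, extended continuously beyond `x = 1`
  set g : ℝ → ℝ := fun x => (max (1 + y - x) y) ^ (-α) with hg
  have hmax : ∀ x, 0 < max (1 + y - x) y := fun x => lt_max_of_lt_right hy
  have hgc : Continuous g := by
    refine Continuous.rpow_const (by fun_prop) fun x => Or.inl (hmax x).ne'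
  have hg0 : ∀ x, 0 ≤ g x := fun x => Real.rpow_nonneg (hmax x).le _
  set V := fun i => scaledRenewal (F i) (a i) with hV
  have hVL := fun u (hu : 0 < u) =>
    tendsto_laplaceTransform_scaledRenewal (F := F) (a := a) (l := l) hα₀ hα₁ hU hneg hu
  have hfin : ∀ u, 0 < u → laplaceTransform (powerMeasure c α) u ≠ ∞ := fun u hu => by
    rw [laplaceTransform_powerMeasure hc0.le hα₀ hu]
    exact ENNReal.ofReal_ne_top
  have hV1 : ∀ᶠ i in l, laplaceTransform (V i) 1 ≠ ∞ :=
    (hVL 1 one_pos).eventually_ne (hfin 1 one_pos)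
  -- conversion of limits of integrals over `(-∞, 1)` to the Lebesgue integral
  have hconv : ∀ h : ℝ → ℝ, Continuous h → (∀ x, 0 ≤ h x) →
      Tendsto (fun i => ∫⁻ x in Iio 1, ENNReal.ofReal (h x) ∂(V i)) l
        (𝓝 (∫⁻ x in Iio 1, ENNReal.ofReal (h x) ∂(powerMeasure c α))) ∧
      ∫⁻ x in Iio 1, ENNReal.ofReal (h x) ∂(powerMeasure c α) ≠ ∞ := by
    intro h hh hh0
    have hI : ∀ m : Measure ℝ, (∀ᵐ x ∂m, 0 ≤ x) → laplaceTransform m 1 ≠ ∞ →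
        ∫⁻ x in Iio 1, ENNReal.ofReal (h x) ∂m = ENNReal.ofReal (∫ x in Iio 1, h x ∂m) := by
      intro m hm hm1
      rw [ofReal_integral_eq_lintegral_ofReal _ (ae_of_all _ hh0)]
      rw [← IntegrableOn, ← integrable_indicator_iff measurableSet_Iio]
      refine (integrable_of_laplaceTransform_ne_top hm hm1
        (hh.mul (continuous_ramp 1 1)) (K := 2) fun x hx => ?_).mono'
        (hh.aestronglyMeasurable.indicator measurableSet_Iio) (ae_of_all _ fun x => ?_)
      · rw [Pi.mul_apply, ramp_eq_zero (by linarith), mul_zero]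
      · by_cases hx : x < 1
        · rw [indicator_of_mem (by simpa using hx), Real.norm_of_nonneg (hh0 x),
            Pi.mul_apply, ramp_eq_one zero_le_one hx.le, mul_one]
        · rw [indicator_of_notMem (by simpa using hx), norm_zero]
          exact mul_nonneg (hh0 x) (ramp_nonneg _ _ _)
    rw [hI _ (ae_nonneg_powerMeasure c α) (hfin 1 one_pos)]
    refine ⟨?_, ENNReal.ofReal_ne_top⟩
    refine (ENNReal.tendsto_ofReal (tendsto_setIntegral_Iio_of_tendsto_laplaceTransform
      (fun i => ae_nonneg_scaledRenewal (F i) (a i)) (ae_nonneg_powerMeasure c α) hfin hVL hh hh0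
      (powerMeasure_singleton c α 1))).congr' ?_
    filter_upwards [hV1] with i hi
    exact (hI _ (ae_nonneg_scaledRenewal _ _) hi).symm
  obtain ⟨hGlim, hGfin⟩ := hconv g hgc hg0
  obtain ⟨hmlim, hmfin⟩ := hconv (fun _ => 1) continuous_const fun _ => zero_le_one
  have hGval : ∫⁻ x in Iio 1, ENNReal.ofReal (g x) ∂(powerMeasure c α) =
      dynkinLaw α (Ioi y) := by
    rw [dynkinLaw_Ioi hα₀ hα₁ hy.le, ← lintegral_indicator measurableSet_Iio,
      lintegral_powerMeasure _ _ ((by fun_prop : Measurable fun x =>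
        ENNReal.ofReal (g x)).indicator measurableSet_Iio), ← lintegral_indicator measurableSet_Ioi,
      ← lintegral_indicator measurableSet_Ioo]
    refine lintegral_congr fun x => ?_
    by_cases hx0 : 0 < x
    · by_cases hx1 : x < 1
      · rw [indicator_of_mem (by simpa using hx0), indicator_of_mem (by simpa using hx1),
          indicator_of_mem (show x ∈ Ioo 0 1 from ⟨hx0, hx1⟩)]
        simp only [hg]
        rw [max_eq_left (by linarith)]
      · rw [indicator_of_mem (by simpa using hx0), indicator_of_notMem (by simpa using hx1),
          indicator_of_notMem fun h => hx1 h.2, mul_zero]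
    · rw [indicator_of_notMem (by simpa using hx0), indicator_of_notMem fun h => hx0 h.1]
  rw [hGval] at hGlim hGfin
  refine tendsto_of_forall_eventually_le_add hGfin hGlim fun δ hδ => ?_
  -- the visits to the negative half-line and those after the passage are negligible
  have herr : Tendsto (fun i => F i (Ioi y) * renewalMeasure (F i) (Iio 0)) l (𝓝 0) := by
    have h1 : Tendsto (fun i => ENNReal.ofReal ((F i).real (Ioi y) / a i) *
        (ENNReal.ofReal (a i) * ∫⁻ x in Iio 0, ENNReal.ofReal (Real.exp (-(1 * x)))
          ∂(renewalMeasure (F i)))) l (𝓝 (ENNReal.ofReal (y ^ (-α)) * 0)) :=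
      ENNReal.Tendsto.mul (ENNReal.tendsto_ofReal (htail y hy)) (Or.inr ENNReal.zero_ne_top)
        (hneg 1 one_pos) (Or.inr ENNReal.ofReal_ne_top)
    rw [mul_zero] at h1
    refine tendsto_of_tendsto_of_tendsto_of_le_of_le' tendsto_const_nhds h1
      (Eventually.of_forall fun i => zero_le) ?_
    filter_upwards [hapos] with i hi
    rw [← mul_assoc, ← ENNReal.ofReal_mul (by positivity), div_mul_cancel₀ _ hi.ne',
      ofReal_measureReal]
    gcongr
    rw [← setLIntegral_one]
    refine setLIntegral_mono' measurableSet_Iio fun x hx => ?_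
    have hx' : x < 0 := hx
    exact ENNReal.one_le_ofReal.2 (Real.one_le_exp (by linarith))
  -- choice of the accuracy of the uniform approximation of the tails
  obtain ⟨η, hη, hηm⟩ : ∃ η : ℝ, 0 < η ∧
      ENNReal.ofReal η * (∫⁻ x in Iio 1, ENNReal.ofReal 1 ∂(powerMeasure c α) + 1) ≤ δ / 2 := by
    have hne : ∫⁻ x in Iio 1, ENNReal.ofReal 1 ∂(powerMeasure c α) + 1 ≠ ∞ :=
      ENNReal.add_ne_top.2 ⟨hmfin, ENNReal.one_ne_top⟩
    have hlim : Tendsto (fun η : ℝ => ENNReal.ofReal η *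
        (∫⁻ x in Iio 1, ENNReal.ofReal 1 ∂(powerMeasure c α) + 1)) (𝓝[>] 0) (𝓝 0) := by
      have h0 : Tendsto (fun η : ℝ => ENNReal.ofReal η) (𝓝[>] 0) (𝓝 0) := by
        have := (ENNReal.continuous_ofReal.tendsto 0).mono_left (nhdsWithin_le_nhds (s := Ioi 0))
        simpa using this
      have := ENNReal.Tendsto.mul_const h0 (Or.inr hne)
      rwa [zero_mul] at this
    obtain ⟨η, h1, h2⟩ := ((hlim.eventually_lt_const (ENNReal.half_pos hδ.ne')).and
      self_mem_nhdsWithin).exists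
    exact ⟨η, h2, h1.le⟩
  have hunif := tendstoUniformlyOn_of_antitone
    (f := fun i z => (F i).real (Ioi z) / a i) (g := fun z => z ^ (-α)) (l := l)
    (by
      filter_upwards [hapos] with i hi z w hzw
      exact div_le_div_of_nonneg_right (measureReal_mono (Ioi_subset_Ioi hzw)) hi.le)
    (fun z hz => (Real.continuousAt_rpow_const _ _ (Or.inl (ne_of_gt hz))).continuousWithinAt)
    htail (a := y) (b := 1 + y) hy
  rw [Metric.tendstoUniformlyOn_iff] at hunif
  filter_upwards [hunif η hη, hapos, herr.eventually_le_const (ENNReal.div_pos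
    (ENNReal.half_pos hδ.ne').ne' (by simp) : 0 < δ / 2 / 2),
    hmlim.eventually_le_const (ENNReal.lt_add_right hmfin one_ne_zero)] with i hu hai he hm
  have hηm' : ENNReal.ofReal η * ∫⁻ x in Iio 1, ENNReal.ofReal 1 ∂(V i) ≤ δ / 2 := by
    refine le_trans ?_ hηm
    gcongr
  set J := ∫⁻ x in Ico 0 1, F i (Ioi (1 + y - x)) ∂(renewalMeasure (F i)) with hJ
  have hVint : ∀ f : ℝ → ℝ≥0∞, ∫⁻ x in Iio 1, f x ∂(V i) =
      ENNReal.ofReal (a i) * ∫⁻ x in Ico 0 1, f x ∂(renewalMeasure (F i)) := by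
    intro f
    simp only [hV, scaledRenewal]
    rw [Measure.restrict_smul, Measure.restrict_restrict measurableSet_Iio, Iio_inter_Ici,
      lintegral_smul_measure, smul_eq_mul]
  have hpt : ∀ x ∈ Ico (0 : ℝ) 1, |g x - (F i).real (Ioi (1 + y - x)) / a i| < η := by
    intro x hx
    have := hu (1 + y - x) ⟨by linarith [hx.2], by linarith [hx.1]⟩
    rw [Real.dist_eq] at this
    simp only [hg]
    rwa [max_eq_left (by linarith [hx.2])]
  have hJle : J ≤ ∫⁻ x in Iio 1, ENNReal.ofReal (g x) ∂(V i) + δ / 2 := by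
    refine le_trans ?_ (add_le_add_right hηm' _)
    rw [hVint, hVint, mul_left_comm, ← mul_add, ← lintegral_const_mul' _ _ ENNReal.ofReal_ne_top,
      ← lintegral_add_left (by fun_prop), ← lintegral_const_mul' _ _ ENNReal.ofReal_ne_top]
    refine setLIntegral_mono' measurableSet_Ico fun x hx => ?_
    rw [ENNReal.ofReal_one, mul_one, ← ENNReal.ofReal_add (hg0 x) hη.le,
      ← ENNReal.ofReal_mul hai.le, ← ofReal_measureReal]
    refine ENNReal.ofReal_le_ofReal ?_
    have := (abs_lt.1 (hpt x hx)).1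
    rw [← div_le_iff₀' hai]
    linarith
  have hleJ : ∫⁻ x in Iio 1, ENNReal.ofReal (g x) ∂(V i) ≤ J + δ / 2 := by
    refine le_trans ?_ (add_le_add_right hηm' _)
    rw [hVint, hVint, mul_left_comm, ← lintegral_const_mul' _ _ ENNReal.ofReal_ne_top,
      ← lintegral_const_mul' _ _ ENNReal.ofReal_ne_top,
      ← lintegral_const_mul' _ _ ENNReal.ofReal_ne_top,
      ← lintegral_add_left (measurable_tail_sub _ _)]
    refine setLIntegral_mono' measurableSet_Ico fun x hx => ?_
    rw [ENNReal.ofReal_one, mul_one, ← ENNReal.ofReal_mul hai.le, ← ENNReal.ofReal_mul hai.le,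
      ← ofReal_measureReal, ← ENNReal.ofReal_add measureReal_nonneg (by positivity)]
    refine ENNReal.ofReal_le_ofReal ?_
    have := (abs_lt.1 (hpt x hx)).2
    have h2 : g x ≤ (F i).real (Ioi (1 + y - x)) / a i + η := by linarith
    calc a i * g x ≤ a i * ((F i).real (Ioi (1 + y - x)) / a i + η) := by gcongr
      _ = _ := by field_simp
  have hsplit : ∫⁻ x in Iio 1, F i (Ioi (1 + y - x)) ∂(renewalMeasure (F i)) ≤ J +
      F i (Ioi y) * renewalMeasure (F i) (Iio 0) := by
    have hun : Iio (1 : ℝ) = Ico 0 1 ∪ Iio 0 := by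
      ext x
      simp only [mem_Iio, mem_union, mem_Ico]
      constructor
      · intro h
        rcases le_or_gt 0 x with h0 | h0
        · exact Or.inl ⟨h0, h⟩
        · exact Or.inr h0
      · rintro (h | h) <;> linarith
    rw [hun]
    refine (lintegral_union_le _ _ _).trans ?_
    gcongr
    rw [← setLIntegral_const]
    refine setLIntegral_mono' measurableSet_Iio fun x hx => ?_
    have hx' : x < 0 := hx
    exact antitone_tail (F i) (by linarith)
  have hup := exitLaw_Ioi_le (F i) hy.le
  have hlow := setLIntegral_renewalMeasure_le (F i) hy.le
  have hJI : J ≤ ∫⁻ x in Iio 1, F i (Ioi (1 + y - x)) ∂(renewalMeasure (F i)) :=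
    lintegral_mono_set fun x hx => hx.2
  have he' : F i (Ioi y) * renewalMeasure (F i) (Iio 0) ≤ δ / 2 :=
    he.trans ENNReal.half_le_self
  constructor
  · calc exitLaw (F i) (Ioi (1 + y)) ≤ J + δ / 2 :=
          hup.trans (hsplit.trans (add_le_add_right he' _))
      _ ≤ ∫⁻ x in Iio 1, ENNReal.ofReal (g x) ∂(V i) + δ / 2 + δ / 2 :=
          add_le_add_left hJle _
      _ = _ := by rw [add_assoc, ENNReal.add_halves]
  · calc ∫⁻ x in Iio 1, ENNReal.ofReal (g x) ∂(V i) ≤ J + δ / 2 := hleJ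
      _ ≤ exitLaw (F i) (Ioi (1 + y)) + δ / 2 + δ / 2 :=
          add_le_add_left (hJI.trans (hlow.trans (add_le_add_right he' _))) _
      _ = _ := by rw [add_assoc, ENNReal.add_halves]

end

/-! ### Laplace transforms and tails -/

/-- Integration by parts for the Laplace transform. -/
theorem lintegral_one_sub_exp (m : Measure ℝ) {u : ℝ} (hu : 0 < u) :
    ∫⁻ x in Ioi 0, ENNReal.ofReal (1 - Real.exp (-(u * x))) ∂m =
      ∫⁻ t in Ioi 0, m (Ioi t) * ENNReal.ofReal (u * Real.exp (-(u * t))) := by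
  have hint (x : ℝ) : ∫ t in (0 : ℝ)..x, u * Real.exp (-(u * t)) = 1 - Real.exp (-(u * x)) := by
    have hd : ∀ t ∈ uIcc 0 x, HasDerivAt (fun t => -Real.exp (-(u * t)))
        (u * Real.exp (-(u * t))) t := fun t _ => by
      have := (((hasDerivAt_id t).const_mul u).neg.exp).neg
      convert! this using 1
      simp
      ring
    rw [intervalIntegral.integral_eq_sub_of_hasDerivAt hd
      (Continuous.intervalIntegrable (by fun_prop) _ _)]
    simp
    ring
  have h := lintegral_comp_eq_lintegral_meas_lt_mul (m.restrict (Ioi 0)) (f := fun x => x)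
    (g := fun t => u * Real.exp (-(u * t)))
    (by filter_upwards [ae_restrict_mem measurableSet_Ioi] with x hx using le_of_lt hx)
    measurable_id.aemeasurable
    (fun t _ => Continuous.intervalIntegrable (by fun_prop) _ _)
    (ae_of_all _ fun t => by positivity)
  simp_rw [hint] at h
  rw [h]
  refine setLIntegral_congr_fun measurableSet_Ioi fun t ht => ?_
  have ht' : 0 < t := ht
  have hs : {a : ℝ | t < a} ∩ Ioi 0 = Ioi t := inter_eq_left.2 fun x hx => ht'.trans hx
  change (m.restrict (Ioi 0)) (Ioi t) * _ = _
  rw [Measure.restrict_apply measurableSet_Ioi]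
  congr 2

theorem lintegral_rpow_mul_exp {α : ℝ} (hα₁ : α < 1) {u : ℝ} (hu : 0 < u) :
    ∫⁻ t in Ioi 0, ENNReal.ofReal (t ^ (-α)) * ENNReal.ofReal (u * Real.exp (-(u * t))) =
      ENNReal.ofReal (u ^ α * Real.Gamma (1 - α)) := by
  have h := laplaceTransform_powerMeasure (c := u) hu.le (sub_pos.2 hα₁) hu
  rw [laplaceTransform, lintegral_powerMeasure _ _ (by fun_prop)] at h
  rw [← mul_assoc, one_div, Real.inv_rpow hu.le, ← Real.rpow_neg hu.le] at h
  have e : u * u ^ (-(1 - α)) = u ^ α := by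
    nth_rw 1 [← Real.rpow_one u]
    rw [← Real.rpow_add hu]
    ring_nf
  rw [e] at h
  rw [← h]
  refine setLIntegral_congr_fun measurableSet_Ioi fun t ht => ?_
  have ht' : 0 < t := ht
  rw [← ENNReal.ofReal_mul (by positivity), ← ENNReal.ofReal_mul (by positivity)]
  congr 1
  rw [show 1 - α - 1 = -α by ring]
  ring

section

variable {ι : Type*} {l : Filter ι} {F : ι → Measure ℝ} {a : ι → ℝ} {u K : ℝ}

theorem tendsto_mul_inv_one_sub_laplaceTransform (hK : 0 < K) (ha : ∀ᶠ i in l, 0 < a i)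
    (hfin : ∀ᶠ i in l, laplaceTransform (F i) u ≠ ∞)
    (h : Tendsto (fun i => (1 - (laplaceTransform (F i) u).toReal) / a i) l (𝓝 K)) :
    Tendsto (fun i => ENNReal.ofReal (a i) * (1 - laplaceTransform (F i) u)⁻¹) l
      (𝓝 (ENNReal.ofReal K⁻¹)) := by
  refine (ENNReal.tendsto_ofReal (h.inv₀ hK.ne')).congr' ?_
  filter_upwards [ha, hfin, h.eventually_const_lt hK] with i hai hi hpos
  have h1 : 0 < 1 - (laplaceTransform (F i) u).toReal := by
    by_contra hn
    exact absurd hpos (not_lt.2 (div_nonpos_of_nonpos_of_nonneg (not_lt.1 hn) hai.le))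
  have h2 : 1 - laplaceTransform (F i) u =
      ENNReal.ofReal (1 - (laplaceTransform (F i) u).toReal) := by
    rw [ENNReal.ofReal_sub _ ENNReal.toReal_nonneg, ENNReal.ofReal_one, ENNReal.ofReal_toReal hi]
  rw [h2, ← ENNReal.ofReal_inv_of_pos h1, ← ENNReal.ofReal_mul hai.le, inv_div, div_eq_mul_inv]

end

theorem laplaceTransform_map_div (F : Measure ℝ) (r u : ℝ) :
    laplaceTransform (F.map (fun x => x / r)) u = laplaceTransform F (u / r) := by
  rw [laplaceTransform, lintegral_map (by fun_prop) (by fun_prop)]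
  refine lintegral_congr fun x => ?_
  congr 3
  ring

/-- Splitting `1 - ∫ exp (-u x) F(dx)` according to the sign of `x`. -/
theorem laplaceTransform_add_lintegral (F : Measure ℝ) [IsProbabilityMeasure F] {u : ℝ}
    (hu : 0 ≤ u) :
    laplaceTransform F u + ∫⁻ x in Ioi 0, ENNReal.ofReal (1 - Real.exp (-(u * x))) ∂F =
      1 + ∫⁻ x in Iio 0, ENNReal.ofReal (Real.exp (-(u * x)) - 1) ∂F := by
  rw [laplaceTransform, ← lintegral_indicator measurableSet_Ioi,
    ← lintegral_indicator measurableSet_Iio, ← lintegral_add_left (by fun_prop)]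
  have h1 : (1 : ℝ≥0∞) = ∫⁻ _, 1 ∂F := by simp
  rw [h1, ← lintegral_add_left (by fun_prop)]
  refine lintegral_congr fun x => ?_
  rcases lt_trichotomy x 0 with hx | hx | hx
  · rw [indicator_of_notMem (by simpa using hx.le), indicator_of_mem (by simpa using hx),
      add_zero, ← ENNReal.ofReal_one, ← ENNReal.ofReal_add zero_le_one]
    · congr 1; ring
    · have : 1 ≤ Real.exp (-(u * x)) := Real.one_le_exp (by nlinarith)
      linarith
  · simp [hx]
  · rw [indicator_of_mem (by simpa using hx), indicator_of_notMem (by simpa using hx.le),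
      add_zero, ← ENNReal.ofReal_add (Real.exp_nonneg _)]
    · simp
    · have : Real.exp (-(u * x)) ≤ 1 := Real.exp_le_one_iff.2 (by nlinarith)
      linarith

/-! ### Regularly varying tails -/

section

variable {F : Measure ℝ} [IsProbabilityMeasure F] {α : ℝ}

/-- **Potter's bound** for a regularly varying tail. -/
theorem exists_tail_le (hα₀ : 0 < α) {β : ℝ} (hαβ : α < β)
    (hF : IsRegularlyVarying (fun x => F.real (Ioi x)) (-α)) :
    ∃ x₀, 0 < x₀ ∧ 0 < F.real (Ioi x₀) ∧ ∀ x r, x₀ ≤ x → x ≤ r →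
      F.real (Ioi x) ≤ (2 * (r / x)) ^ β * F.real (Ioi r) := by
  have h2 := hF.tendsto_ratio 2 two_pos
  have hlt : (2 : ℝ) ^ (-β) < 2 ^ (-α) := Real.rpow_lt_rpow_of_exponent_lt one_lt_two (by linarith)
  obtain ⟨x₀, hx₀⟩ := eventually_atTop.1
    ((h2.eventually_const_lt hlt).and (hF.eventually_pos.and (eventually_gt_atTop 0)))
  refine ⟨x₀, (hx₀ x₀ le_rfl).2.2, (hx₀ x₀ le_rfl).2.1, ?_⟩
  have hpos : 0 < x₀ := (hx₀ x₀ le_rfl).2.2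
  have step : ∀ x, x₀ ≤ x → F.real (Ioi x) ≤ 2 ^ β * F.real (Ioi (2 * x)) := fun x hx => by
    obtain ⟨h1, h3, -⟩ := hx₀ x hx
    rw [lt_div_iff₀ h3, Real.rpow_neg two_pos.le] at h1
    have hb : (0 : ℝ) < 2 ^ β := Real.rpow_pos_of_pos two_pos _
    calc F.real (Ioi x) = 2 ^ β * ((2 ^ β)⁻¹ * F.real (Ioi x)) := by field_simp
      _ ≤ _ := by gcongr
  have iter : ∀ k : ℕ, ∀ x, x₀ ≤ x →
      F.real (Ioi x) ≤ (2 ^ k : ℝ) ^ β * F.real (Ioi (2 ^ k * x)) := by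
    intro k
    induction k with
    | zero => intro x _; simp
    | succ k ih =>
      intro x hx
      have hk : (1 : ℝ) ≤ 2 ^ k := one_le_pow₀ one_le_two
      have hx' : x₀ ≤ 2 ^ k * x := hx.trans (le_mul_of_one_le_left (by linarith) hk)
      calc F.real (Ioi x) ≤ (2 ^ k : ℝ) ^ β * F.real (Ioi (2 ^ k * x)) := ih x hx
        _ ≤ (2 ^ k : ℝ) ^ β * (2 ^ β * F.real (Ioi (2 * (2 ^ k * x)))) := by
          gcongr
          exact step _ hx'
        _ = _ := by
          rw [← mul_assoc, ← Real.mul_rpow (by positivity) two_pos.le, pow_succ]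
          ring_nf
  intro x r hx hxr
  have hx0 : 0 < x := hpos.trans_le hx
  have hr0 : 0 < r := hx0.trans_le hxr
  obtain ⟨n, hn1, hn2⟩ := exists_nat_pow_near (x := r / x) (y := 2) ((one_le_div hx0).2 hxr)
    one_lt_two
  have hr : r ≤ 2 ^ (n + 1) * x := ((div_lt_iff₀ hx0).1 hn2).le
  calc F.real (Ioi x) ≤ (2 ^ (n + 1) : ℝ) ^ β * F.real (Ioi (2 ^ (n + 1) * x)) := iter _ x hx
    _ ≤ (2 * (r / x)) ^ β * F.real (Ioi r) := by
      have h1 : (2 : ℝ) ^ (n + 1) ≤ 2 * (r / x) := by rw [pow_succ]; linarith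
      have h2 : F.real (Ioi (2 ^ (n + 1) * x)) ≤ F.real (Ioi r) :=
        measureReal_mono (Ioi_subset_Ioi hr)
      have h3 : (0 : ℝ) ≤ 2 * (r / x) := by positivity
      have h4 : 0 ≤ β := (hα₀.trans hαβ).le
      gcongr

/-- The ratios `F((r t, ∞)) / F((r, ∞))` are dominated, uniformly in `r`, by a function that is
integrable near zero. -/
theorem exists_tail_ratio_le (hα₀ : 0 < α) {β : ℝ} (hαβ : α < β)
    (hF : IsRegularlyVarying (fun x => F.real (Ioi x)) (-α)) :
    ∃ C, 0 < C ∧ ∀ᶠ r in atTop, C⁻¹ * r ^ (-β) ≤ F.real (Ioi r) ∧ ∀ t, 0 < t →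
      F.real (Ioi (r * t)) / F.real (Ioi r) ≤ C * t ^ (-β) + 1 := by
  obtain ⟨x₀, hx₀, hT, hP⟩ := exists_tail_le hα₀ hαβ hF
  have hβ : 0 < β := hα₀.trans hαβ
  set T := F.real (Ioi x₀)
  have hT1 : T ≤ 1 := measureReal_le_one
  have hC : 0 < 2 ^ β / T := by positivity
  set D := max (2 ^ β / T) ((2 / x₀) ^ β / T)
  have hD : 0 < D := lt_max_of_lt_left hC
  refine ⟨D, hD, ?_⟩
  filter_upwards [eventually_ge_atTop x₀, hF.eventually_pos] with r hr hpos
  have hr0 : 0 < r := hx₀.trans_le hr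
  have hTr : T ≤ (2 * (r / x₀)) ^ β * F.real (Ioi r) := hP x₀ r le_rfl hr
  refine ⟨?_, fun t ht => ?_⟩
  · rw [Real.rpow_neg hr0.le, ← mul_inv, inv_le_iff_one_le_mul₀ (by positivity)]
    have h1 : (2 * (r / x₀)) ^ β = (2 / x₀) ^ β * r ^ β := by
      rw [← Real.mul_rpow (by positivity) hr0.le]; ring_nf
    rw [h1] at hTr
    calc (1 : ℝ) ≤ ((2 / x₀) ^ β * r ^ β * F.real (Ioi r)) / T := by rwa [one_le_div hT]
      _ = ((2 / x₀) ^ β / T) * r ^ β * F.real (Ioi r) := by ring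
      _ ≤ D * r ^ β * F.real (Ioi r) := by gcongr; exact le_max_right _ _
      _ = _ := by ring
  · rcases le_or_gt 1 t with h1 | h1
    · have : F.real (Ioi (r * t)) / F.real (Ioi r) ≤ 1 :=
        (div_le_one hpos).2 (measureReal_mono (Ioi_subset_Ioi (le_mul_of_one_le_right hr0.le h1)))
      have : 0 ≤ D * t ^ (-β) := by positivity
      linarith
    · suffices F.real (Ioi (r * t)) / F.real (Ioi r) ≤ 2 ^ β / T * t ^ (-β) by
        have : 2 ^ β / T * t ^ (-β) ≤ D * t ^ (-β) := by
          gcongr; exact le_max_left _ _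
        linarith
      rw [div_le_iff₀ hpos, Real.rpow_neg ht.le, ← Real.inv_rpow ht.le]
      rcases le_or_gt x₀ (r * t) with h2 | h2
      · have h3 := hP (r * t) r h2 (mul_le_of_le_one_right hr0.le h1.le)
        have h4 : 2 * (r / (r * t)) = 2 * t⁻¹ := by field_simp
        rw [h4, Real.mul_rpow two_pos.le (by positivity)] at h3
        calc F.real (Ioi (r * t)) ≤ 2 ^ β * t⁻¹ ^ β * F.real (Ioi r) := h3
          _ ≤ 2 ^ β / T * t⁻¹ ^ β * F.real (Ioi r) := by
            gcongr
            exact le_div_self (by positivity) hT hT1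
      · have h3 : r / x₀ ≤ t⁻¹ := by
          rw [div_le_iff₀ hx₀, inv_mul_eq_div, le_div_iff₀ ht]; exact h2.le
        have h4 : (2 * (r / x₀)) ^ β ≤ 2 ^ β * t⁻¹ ^ β := by
          rw [← Real.mul_rpow two_pos.le (by positivity)]
          gcongr
        calc F.real (Ioi (r * t)) ≤ 1 := measureReal_le_one
          _ ≤ ((2 * (r / x₀)) ^ β * F.real (Ioi r)) / T := by rwa [one_le_div hT]
          _ ≤ (2 ^ β * t⁻¹ ^ β * F.real (Ioi r)) / T := by gcongr
          _ = _ := by ring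

theorem tendsto_tail_zero (F : Measure ℝ) [IsProbabilityMeasure F] :
    Tendsto (fun r => F.real (Ioi r)) atTop (𝓝 0) := by
  have h : (fun r => F.real (Ioi r)) = fun r => 1 - cdf F r := by
    ext r
    rw [cdf_eq_real, ← compl_Iic, probReal_compl_eq_one_sub measurableSet_Iic]
  rw [h]
  simpa using (tendsto_cdf_atTop F).const_sub 1

theorem tendsto_lintegral_tail_ratio (hα₀ : 0 < α) (hα₁ : α < 1)
    (hF : IsRegularlyVarying (fun x => F.real (Ioi x)) (-α)) {u : ℝ} (hu : 0 < u) :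
    Tendsto (fun r => ∫⁻ t in Ioi 0, ENNReal.ofReal (F.real (Ioi (r * t)) / F.real (Ioi r)) *
      ENNReal.ofReal (u * Real.exp (-(u * t)))) atTop
      (𝓝 (ENNReal.ofReal (u ^ α * Real.Gamma (1 - α)))) := by
  obtain ⟨β, hβ1, hβ2⟩ := exists_between hα₁
  obtain ⟨C, hC, hev⟩ := exists_tail_ratio_le hα₀ hβ1 hF
  rw [← lintegral_rpow_mul_exp hα₁ hu]
  refine tendsto_lintegral_filter_of_dominated_convergence
    (fun t => (ENNReal.ofReal C * ENNReal.ofReal (t ^ (-β)) + ENNReal.ofReal (t ^ (-(0 : ℝ)))) *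
      ENNReal.ofReal (u * Real.exp (-(u * t)))) ?_ ?_ ?_ ?_
  · refine Eventually.of_forall fun r => ?_
    have := hF.measurable
    have h2 : Measurable fun t => F.real (Ioi (r * t)) := this.comp (measurable_const_mul r)
    fun_prop
  · filter_upwards [hev] with r hr
    filter_upwards [ae_restrict_mem measurableSet_Ioi] with t ht
    have ht' : 0 < t := ht
    gcongr
    rw [← ENNReal.ofReal_mul hC.le, ← ENNReal.ofReal_add (by positivity) (by positivity)]
    refine ENNReal.ofReal_le_ofReal ((hr.2 t ht').trans (by simp))
  · simp_rw [add_mul, mul_assoc]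
    rw [lintegral_add_left (by fun_prop), lintegral_const_mul _ (by fun_prop),
      lintegral_rpow_mul_exp hβ2 hu, lintegral_rpow_mul_exp one_pos hu]
    finiteness
  · filter_upwards [ae_restrict_mem measurableSet_Ioi] with t ht
    have ht' : 0 < t := ht
    refine ENNReal.Tendsto.mul_const (ENNReal.tendsto_ofReal ?_) (Or.inr ENNReal.ofReal_ne_top)
    have := hF.tendsto_ratio t ht'
    simp_rw [mul_comm t] at this
    exact this

/-- An exponentially light left tail contributes only linearly to the Laplace transform. -/
theorem lintegral_Iio_exp_sub_one_le (F : Measure ℝ) {γ v : ℝ} (hγ : 0 < γ) (hv : 0 ≤ v)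
    (hvγ : v ≤ γ / 2) :
    ∫⁻ x in Iio 0, ENNReal.ofReal (Real.exp (-(v * x)) - 1) ∂F ≤
      ENNReal.ofReal (v * (2 / γ)) * ∫⁻ x in Iio 0, ENNReal.ofReal (Real.exp (-(γ * x))) ∂F := by
  rw [← lintegral_const_mul _ (by fun_prop)]
  refine setLIntegral_mono' measurableSet_Iio fun x hx => ?_
  have hx' : x < 0 := hx
  rw [← ENNReal.ofReal_mul (by positivity)]
  refine ENNReal.ofReal_le_ofReal ?_
  have h1 : Real.exp (-(v * x)) - 1 ≤ v * (-x) * Real.exp (-(v * x)) := by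
    have := Real.add_one_le_exp (v * x)
    have h2 : Real.exp (v * x) * Real.exp (-(v * x)) = 1 := by rw [← Real.exp_add]; simp
    nlinarith [Real.exp_pos (-(v * x))]
  have h2 : Real.exp (-(v * x)) ≤ Real.exp (γ / 2 * (-x)) := Real.exp_le_exp.2 (by nlinarith)
  have h3 : -x ≤ 2 / γ * Real.exp (γ / 2 * (-x)) := by
    have := Real.add_one_le_exp (γ / 2 * (-x))
    calc -x = 2 / γ * (γ / 2 * (-x)) := by field_simp
      _ ≤ _ := by gcongr; linarith
  have hx0 : 0 ≤ -x := by linarith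
  calc Real.exp (-(v * x)) - 1 ≤ v * (-x) * Real.exp (-(v * x)) := h1
    _ ≤ v * (2 / γ * Real.exp (γ / 2 * (-x))) * Real.exp (γ / 2 * (-x)) := by gcongr
    _ = v * (2 / γ) * (Real.exp (γ / 2 * (-x)) * Real.exp (γ / 2 * (-x))) := by ring
    _ = v * (2 / γ) * Real.exp (-(γ * x)) := by rw [← Real.exp_add]; ring_nf

variable {γ : ℝ}

theorem tendsto_one_sub_laplaceTransform_div (hα₀ : 0 < α) (hα₁ : α < 1)
    (hF : IsRegularlyVarying (fun x => F.real (Ioi x)) (-α)) (hγ : 0 < γ)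
    (hleft : ∫⁻ x in Iio 0, ENNReal.ofReal (Real.exp (-(γ * x))) ∂F ≠ ∞) {u : ℝ} (hu : 0 < u) :
    (∀ᶠ r in atTop, laplaceTransform (F.map (fun x => x / r)) u ≠ ∞) ∧
    Tendsto (fun r => (1 - (laplaceTransform (F.map (fun x => x / r)) u).toReal) /
      F.real (Ioi r)) atTop (𝓝 (u ^ α * Real.Gamma (1 - α))) := by
  set N := ∫⁻ x in Iio 0, ENNReal.ofReal (Real.exp (-(γ * x))) ∂F with hN
  set A : ℝ → ℝ≥0∞ := fun r =>
    ∫⁻ x in Ioi 0, ENNReal.ofReal (1 - Real.exp (-(u / r * x))) ∂F with hA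
  set B : ℝ → ℝ≥0∞ := fun r =>
    ∫⁻ x in Iio 0, ENNReal.ofReal (Real.exp (-(u / r * x)) - 1) ∂F with hB
  have hsmall : ∀ᶠ r : ℝ in atTop, u / r ≤ γ / 2 :=
    ((tendsto_const_nhds (x := u)).div_atTop tendsto_id).eventually_le_const (by positivity)
  have hBle : ∀ᶠ r : ℝ in atTop, B r ≤ ENNReal.ofReal (u / r * (2 / γ)) * N := by
    filter_upwards [hsmall, eventually_gt_atTop 0] with r h1 h2
    exact lintegral_Iio_exp_sub_one_le F hγ (by positivity) h1
  have hBfin : ∀ᶠ r : ℝ in atTop, B r ≠ ∞ := by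
    filter_upwards [hBle] with r hr
    exact (hr.trans_lt (ENNReal.mul_lt_top ENNReal.ofReal_lt_top
      (lt_top_iff_ne_top.2 hleft))).ne
  have hAfin : ∀ᶠ r : ℝ in atTop, A r ≠ ∞ := by
    filter_upwards [eventually_gt_atTop 0] with r hr
    refine ((setLIntegral_mono' measurableSet_Ioi (g := fun _ => 1) fun x _ => ?_).trans_lt ?_).ne
    · exact ENNReal.ofReal_le_one.2 (by linarith [Real.exp_pos (-(u / r * x))])
    · rw [setLIntegral_one]
      exact measure_lt_top _ _
  have hid : ∀ᶠ r : ℝ in atTop, laplaceTransform (F.map (fun x => x / r)) u + A r = 1 + B r := by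
    filter_upwards [eventually_gt_atTop 0] with r hr
    rw [laplaceTransform_map_div]
    exact laplaceTransform_add_lintegral F (by positivity)
  have hLfin : ∀ᶠ r in atTop, laplaceTransform (F.map (fun x => x / r)) u ≠ ∞ := by
    filter_upwards [hid, hBfin] with r h1 h2
    refine ne_top_of_le_ne_top (ENNReal.add_ne_top.2 ⟨ENNReal.one_ne_top, h2⟩) (h1 ▸ le_self_add)
  refine ⟨hLfin, ?_⟩
  have hAlim : Tendsto (fun r => (A r).toReal / F.real (Ioi r)) atTop
      (𝓝 (u ^ α * Real.Gamma (1 - α))) := by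
    have h := (ENNReal.tendsto_toReal ENNReal.ofReal_ne_top).comp
      (tendsto_lintegral_tail_ratio hα₀ hα₁ hF hu)
    rw [ENNReal.toReal_ofReal (mul_nonneg (by positivity)
      (Real.Gamma_pos_of_pos (by linarith)).le)] at h
    refine h.congr' ?_
    filter_upwards [eventually_gt_atTop 0, hF.eventually_pos] with r hr hpos
    have e1 : A r = ∫⁻ x in Ioi 0, ENNReal.ofReal (1 - Real.exp (-(u * x)))
        ∂(F.map (fun x => x / r)) := by
      rw [setLIntegral_map measurableSet_Ioi (by fun_prop) (by fun_prop)]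
      have : (fun x => x / r) ⁻¹' Ioi 0 = Ioi 0 := by
        ext x; simp [div_pos_iff_of_pos_right hr]
      rw [this]
      simp only [hA]
      refine lintegral_congr fun x => ?_
      congr 4
      ring
    rw [e1, lintegral_one_sub_exp _ hu, Function.comp_apply, eq_div_iff hpos.ne',
      ← ENNReal.toReal_ofReal hpos.le, ← ENNReal.toReal_mul, mul_comm,
      ← lintegral_const_mul' _ _ ENNReal.ofReal_ne_top]
    congr 1
    refine lintegral_congr fun t => ?_
    rw [← mul_assoc, ENNReal.toReal_ofReal hpos.le, ← ENNReal.ofReal_mul hpos.le,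
      Measure.map_apply (by fun_prop) measurableSet_Ioi]
    have : (fun x => x / r) ⁻¹' Ioi t = Ioi (r * t) := by
      ext x; simp [lt_div_iff₀' hr]
    rw [this, mul_div_cancel₀ _ hpos.ne', ofReal_measureReal]
  have hBlim : Tendsto (fun r => (B r).toReal / F.real (Ioi r)) atTop (𝓝 0) := by
    obtain ⟨β, hβ1, hβ2⟩ := exists_between hα₁
    obtain ⟨C, hC, hev⟩ := exists_tail_ratio_le hα₀ hβ1 hF
    have hlim : Tendsto (fun r : ℝ => u * (2 / γ) * N.toReal * C * r ^ (-(1 - β))) atTop (𝓝 0) := by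
      have := (tendsto_rpow_neg_atTop (sub_pos.2 hβ2)).const_mul (u * (2 / γ) * N.toReal * C)
      rwa [mul_zero] at this
    refine tendsto_of_tendsto_of_tendsto_of_le_of_le' tendsto_const_nhds hlim
      (Eventually.of_forall fun r => by positivity) ?_
    filter_upwards [hBle, hev, eventually_gt_atTop 0, hF.eventually_pos] with r h1 h2 hr hpos
    have h3 : (B r).toReal ≤ u / r * (2 / γ) * N.toReal := by
      have := ENNReal.toReal_mono (ENNReal.mul_ne_top ENNReal.ofReal_ne_top hleft) h1
      rwa [ENNReal.toReal_mul, ENNReal.toReal_ofReal (by positivity)] at this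
    have hCr : 0 < C⁻¹ * r ^ (-β) := by positivity
    calc (B r).toReal / F.real (Ioi r) ≤ (u / r * (2 / γ) * N.toReal) / (C⁻¹ * r ^ (-β)) := by
          gcongr; exact h2.1
      _ = u * (2 / γ) * N.toReal * C * r ^ (-(1 - β)) := by
          have e : r ^ (-(1 - β)) = (r * r ^ (-β))⁻¹ := by
            nth_rw 2 [← Real.rpow_one r]
            rw [← Real.rpow_add hr, ← Real.rpow_neg hr.le]
            ring_nf
          rw [e]
          field_simp
  have := hAlim.sub hBlim
  rw [sub_zero] at this
  refine this.congr' ?_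
  filter_upwards [hid, hAfin, hBfin, hLfin] with r h1 h2 h3 h4
  have h5 := congrArg ENNReal.toReal h1
  rw [ENNReal.toReal_add h4 h2, ENNReal.toReal_add ENNReal.one_ne_top h3,
    ENNReal.toReal_one] at h5
  rw [← sub_div]
  congr 1
  linarith

theorem exists_laplaceTransform_lt_one (hα₀ : 0 < α) (hα₁ : α < 1)
    (hF : IsRegularlyVarying (fun x => F.real (Ioi x)) (-α)) (hγ : 0 < γ)
    (hleft : ∫⁻ x in Iio 0, ENNReal.ofReal (Real.exp (-(γ * x))) ∂F ≠ ∞) :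
    ∃ v, 0 < v ∧ laplaceTransform F v < 1 := by
  obtain ⟨h1, h2⟩ := tendsto_one_sub_laplaceTransform_div hα₀ hα₁ hF hγ hleft one_pos
  have hK : 0 < (1 : ℝ) ^ α * Real.Gamma (1 - α) :=
    mul_pos (by positivity) (Real.Gamma_pos_of_pos (by linarith))
  obtain ⟨r, hr1, hr2, hr3, hr4⟩ := (h1.and ((h2.eventually_const_lt hK).and
    ((eventually_gt_atTop 0).and hF.eventually_pos))).exists
  refine ⟨1 / r, by positivity, ?_⟩
  rw [laplaceTransform_map_div] at hr1 hr2
  have h3 : 0 < 1 - (laplaceTransform F (1 / r)).toReal := by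
    by_contra hn
    exact absurd hr2 (not_lt.2 (div_nonpos_of_nonpos_of_nonneg (not_lt.1 hn) hr4.le))
  rw [← ENNReal.toReal_lt_toReal hr1 ENNReal.one_ne_top, ENNReal.toReal_one]
  linarith

/-- The overshoot theorem for a step law with regularly varying right tail and exponentially
light left tail. -/
theorem tendsto_exitLaw_map_div (hα₀ : 0 < α) (hα₁ : α < 1)
    (hF : IsRegularlyVarying (fun x => F.real (Ioi x)) (-α)) (hγ : 0 < γ)
    (hleft : ∫⁻ x in Iio 0, ENNReal.ofReal (Real.exp (-(γ * x))) ∂F ≠ ∞) {y : ℝ} (hy : 0 < y) :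
    Tendsto (fun r => exitLaw (F.map (fun x => x / r)) (Ioi (1 + y))) atTop
      (𝓝 (dynkinLaw α (Ioi y))) := by
  have hprob : ∀ r : ℝ, IsProbabilityMeasure (F.map (fun x => x / r)) := fun r =>
    Measure.isProbabilityMeasure_map (by fun_prop)
  refine tendsto_exitLaw_Ioi (a := fun r => F.real (Ioi r)) hα₀ hα₁ hF.eventually_pos ?_ ?_ ?_ hy
  · intro z hz
    refine (hF.tendsto_ratio z hz).congr' ?_
    filter_upwards [eventually_gt_atTop 0] with r hr
    rw [map_measureReal_apply (by fun_prop) measurableSet_Ioi]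
    congr 2
    ext x
    simp [lt_div_iff₀ hr]
  · intro u hu
    obtain ⟨h1, h2⟩ := tendsto_one_sub_laplaceTransform_div hα₀ hα₁ hF hγ hleft hu
    have hK : 0 < u ^ α * Real.Gamma (1 - α) :=
      mul_pos (by positivity) (Real.Gamma_pos_of_pos (by linarith))
    have := tendsto_mul_inv_one_sub_laplaceTransform hK hF.eventually_pos h1 h2
    rwa [mul_inv, ← Real.inv_rpow hu.le, ← one_div] at this
  · intro u hu
    obtain ⟨v, hv, hv1⟩ := exists_laplaceTransform_lt_one hα₀ hα₁ hF hγ hleft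
    have hlim : Tendsto (fun r => ENNReal.ofReal (F.real (Ioi r)) * (1 - laplaceTransform F v)⁻¹)
        atTop (𝓝 (ENNReal.ofReal 0 * (1 - laplaceTransform F v)⁻¹)) :=
      ENNReal.Tendsto.mul_const (ENNReal.tendsto_ofReal (tendsto_tail_zero F))
        (Or.inr (ENNReal.inv_ne_top.2 (tsub_pos_of_lt hv1).ne'))
    rw [ENNReal.ofReal_zero, zero_mul] at hlim
    refine tendsto_of_tendsto_of_tendsto_of_le_of_le' tendsto_const_nhds hlim
      (Eventually.of_forall fun _ => zero_le) ?_
    filter_upwards [eventually_ge_atTop (u / v), eventually_gt_atTop 0] with r hr hr0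
    gcongr
    have huv : u ≤ v * r := by rwa [div_le_iff₀' hv] at hr
    have e : laplaceTransform F v = laplaceTransform (F.map (fun x => x / r)) (v * r) := by
      rw [laplaceTransform_map_div, mul_div_cancel_right₀ _ hr0.ne']
    rw [e, ← laplaceTransform_renewalMeasure]
    refine (setLIntegral_mono' measurableSet_Iio fun x hx => ?_).trans
      (setLIntegral_le_lintegral _ _)
    have hx' : x < 0 := hx
    exact ENNReal.ofReal_le_ofReal (Real.exp_le_exp.2 (by nlinarith))

end

/-! ### A monotone density theorem -/

theorem measure_Iio_ne_top_of_laplaceTransform_ne_top {μ : Measure ℝ}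
    (h : laplaceTransform μ 1 ≠ ∞) (c : ℝ) : μ (Iio c) ≠ ∞ := by
  have hle : μ (Iio c) ≤ ENNReal.ofReal (Real.exp c) * laplaceTransform μ 1 := by
    rw [laplaceTransform, ← lintegral_const_mul _ (by fun_prop), ← setLIntegral_one]
    refine (setLIntegral_mono' measurableSet_Iio fun x hx => ?_).trans
      (setLIntegral_le_lintegral _ _)
    have hx' : x < c := hx
    rw [← ENNReal.ofReal_mul (Real.exp_nonneg _), ← Real.exp_add]
    exact ENNReal.one_le_ofReal.2 (Real.one_le_exp (by linarith))
  exact ne_top_of_le_ne_top (ENNReal.mul_ne_top ENNReal.ofReal_ne_top h) hle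

section

variable {ι : Type*} {l : Filter ι} {μ : ι → Measure ℝ} {ν : Measure ℝ}

theorem tendsto_measure_Ico_of_tendsto_laplaceTransform
    (hμ : ∀ i, ∀ᵐ x ∂(μ i), 0 ≤ x) (hν : ∀ᵐ x ∂ν, 0 ≤ x)
    (hfin : ∀ u, 0 < u → laplaceTransform ν u ≠ ∞)
    (hL : ∀ u, 0 < u → Tendsto (fun i => laplaceTransform (μ i) u) l (𝓝 (laplaceTransform ν u)))
    {a b : ℝ} (hab : a ≤ b) (ha : ν {a} = 0) (hb : ν {b} = 0) :
    Tendsto (fun i => (μ i).real (Ico a b)) l (𝓝 (ν.real (Ico a b))) := by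
  have key (c : ℝ) (hc : ν {c} = 0) :
      Tendsto (fun i => (μ i).real (Iio c)) l (𝓝 (ν.real (Iio c))) := by
    have := tendsto_setIntegral_Iio_of_tendsto_laplaceTransform hμ hν hfin hL
      (g := fun _ => 1) continuous_const (fun _ => zero_le_one) hc
    simpa using this
  have hdiff (m : Measure ℝ) (hm : laplaceTransform m 1 ≠ ∞) :
      m.real (Ico a b) = m.real (Iio b) - m.real (Iio a) := by
    have hs : Iio b \ Iio a = Ico a b := by ext x; simp
    rw [← hs, measureReal_sdiff (Iio_subset_Iio hab) measurableSet_Iio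
      (measure_Iio_ne_top_of_laplaceTransform_ne_top hm b)]
  rw [hdiff ν (hfin 1 one_pos)]
  refine ((key b hb).sub (key a ha)).congr' ?_
  filter_upwards [(hL 1 one_pos).eventually_ne (hfin 1 one_pos)] with i hi
  exact (hdiff _ hi).symm

/-- **Monotone density theorem**: if the Laplace transforms of antitone functions converge to that
of a power function, then the functions converge pointwise. -/
theorem tendsto_antitone_of_tendsto_laplaceTransform {f : ι → ℝ → ℝ} {α : ℝ} (hα₀ : 0 < α)
    (hα₁ : α < 1) (hf : ∀ i, Antitone (f i)) (hf0 : ∀ i x, 0 ≤ f i x)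
    (hL : ∀ u, 0 < u → Tendsto (fun i => ∫⁻ t in Ioi 0, ENNReal.ofReal (f i t) *
      ENNReal.ofReal (Real.exp (-(u * t)))) l
        (𝓝 (ENNReal.ofReal ((1 / u) ^ (1 - α) * Real.Gamma (1 - α)))))
    {z : ℝ} (hz : 0 < z) : Tendsto (fun i => f i z) l (𝓝 (z ^ (-α))) := by
  set ν := powerMeasure 1 (1 - α) with hν
  set μ : ι → Measure ℝ := fun i =>
    (volume.restrict (Ioi 0)).withDensity fun x => ENNReal.ofReal (f i x) with hμ
  have hfm (i : ι) : Measurable (f i) := (hf i).measurable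
  have hν0 := ae_nonneg_powerMeasure 1 (1 - α)
  have hμ0 (i : ι) : ∀ᵐ x ∂(μ i), 0 ≤ x := by
    refine (withDensity_absolutelyContinuous _ _).ae_le ?_
    filter_upwards [ae_restrict_mem measurableSet_Ioi] with x hx
    exact le_of_lt hx
  have hνL (u : ℝ) (hu : 0 < u) : laplaceTransform ν u =
      ENNReal.ofReal ((1 / u) ^ (1 - α) * Real.Gamma (1 - α)) := by
    rw [hν, laplaceTransform_powerMeasure zero_le_one (sub_pos.2 hα₁) hu, one_mul]
  have hLμ (u : ℝ) (hu : 0 < u) : Tendsto (fun i => laplaceTransform (μ i) u) l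
      (𝓝 (laplaceTransform ν u)) := by
    rw [hνL u hu]
    refine (hL u hu).congr fun i => ?_
    simp only [hμ, laplaceTransform]
    rw [lintegral_withDensity_eq_lintegral_mul _ ((hfm i).ennreal_ofReal) (by fun_prop)]
    rfl
  have hIco {a b : ℝ} (ha : 0 < a) (hab : a < b) :=
    tendsto_measure_Ico_of_tendsto_laplaceTransform hμ0 hν0
      (fun u hu => hνL u hu ▸ ENNReal.ofReal_ne_top) hLμ hab.le
      (powerMeasure_singleton 1 (1 - α) a) (powerMeasure_singleton 1 (1 - α) b)
  have hvol {a b : ℝ} (ha : 0 < a) (f : ℝ → ℝ) :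
      ((volume.restrict (Ioi 0)).withDensity fun x => ENNReal.ofReal (f x)) (Ico a b) =
        ∫⁻ x in Ico a b, ENNReal.ofReal (f x) := by
    have : Ico a b ∩ Ioi 0 = Ico a b := inter_eq_left.2 fun x hx => ha.trans_le hx.1
    rw [withDensity_apply _ measurableSet_Ico, Measure.restrict_restrict measurableSet_Ico, this]
  -- bounds for the mass of an interval by the endpoint values of an antitone density
  have hub {a b : ℝ} (ha : 0 < a) (hab : a < b) (f : ℝ → ℝ) (hf : AntitoneOn f (Ioi 0))
      (hfa : 0 ≤ f a) : ((volume.restrict (Ioi 0)).withDensity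
        fun x => ENNReal.ofReal (f x)).real (Ico a b) ≤ f a * (b - a) := by
    refine ENNReal.toReal_le_of_le_ofReal (by have := sub_pos.2 hab; positivity) ?_
    rw [hvol ha, ENNReal.ofReal_mul hfa, ← Real.volume_Ico, ← setLIntegral_const]
    exact setLIntegral_mono' measurableSet_Ico fun x hx =>
      ENNReal.ofReal_le_ofReal (hf ha (ha.trans_le hx.1) hx.1)
  have hlb {a b : ℝ} (ha : 0 < a) (hab : a < b) (f : ℝ → ℝ) (hf : AntitoneOn f (Ioi 0))
      (hfb : 0 ≤ f b) : f b * (b - a) ≤ ((volume.restrict (Ioi 0)).withDensity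
        fun x => ENNReal.ofReal (f x)).real (Ico a b) := by
    refine (ENNReal.ofReal_le_iff_le_toReal ?_).1 ?_
    · rw [hvol ha]
      refine ((setLIntegral_mono' (g := fun _ => ENNReal.ofReal (f a)) measurableSet_Ico
        fun x hx => ENNReal.ofReal_le_ofReal (hf ha (ha.trans_le hx.1) hx.1)).trans_lt ?_).ne
      rw [setLIntegral_const, Real.volume_Ico]
      finiteness
    · rw [hvol ha, ENNReal.ofReal_mul hfb, ← Real.volume_Ico, ← setLIntegral_const]
      exact setLIntegral_mono' measurableSet_Ico fun x hx =>
        ENNReal.ofReal_le_ofReal (hf (ha.trans_le hx.1) (ha.trans hab) hx.2.le)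
  have hpow : AntitoneOn (fun x : ℝ => 1 * x ^ (1 - α - 1)) (Ioi 0) := fun x hx w _ hxw => by
    simp only [one_mul]
    exact Real.rpow_le_rpow_of_nonpos hx hxw (by linarith)
  have hexp : 1 - α - 1 = -α := by ring
  have hcont : ContinuousAt (fun x : ℝ => x ^ (-α)) z :=
    Real.continuousAt_rpow_const _ _ (Or.inl hz.ne')
  refine tendsto_order.2 ⟨fun q hq => ?_, fun q hq => ?_⟩
  · obtain ⟨b, hqb, hzb⟩ := (((hcont.mono_left
      (nhdsWithin_le_nhds (s := Ioi z))).eventually_const_lt hq).and self_mem_nhdsWithin).exists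
    have hzb' : z < b := hzb
    have hm : b ^ (-α) * (b - z) ≤ ν.real (Ico z b) :=
      le_trans (le_of_eq (by simp only [one_mul, hexp]))
        (hlb hz hzb' (fun x => 1 * x ^ (1 - α - 1)) hpow
          (mul_nonneg zero_le_one (Real.rpow_nonneg (hz.trans hzb').le _)))
    have hbz := sub_pos.2 hzb'
    filter_upwards [(hIco hz hzb').eventually_const_lt
      (lt_of_lt_of_le (mul_lt_mul_of_pos_right hqb hbz) hm)] with i hi
    exact lt_of_mul_lt_mul_right
      (hi.trans_le (hub hz hzb' (f i) ((hf i).antitoneOn _) (hf0 i z))) hbz.le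
  · obtain ⟨a, ⟨hqa, haz⟩, ha0⟩ := ((((hcont.mono_left
      (nhdsWithin_le_nhds (s := Iio z))).eventually_lt_const hq).and self_mem_nhdsWithin).and
        (mem_nhdsWithin_of_mem_nhds (Ioi_mem_nhds hz))).exists
    have haz' : a < z := haz
    have ha0' : 0 < a := ha0
    have hm : ν.real (Ico a z) ≤ a ^ (-α) * (z - a) :=
      (hub ha0' haz' (fun x => 1 * x ^ (1 - α - 1)) hpow
        (mul_nonneg zero_le_one (Real.rpow_nonneg ha0'.le _))).trans
          (le_of_eq (by simp only [one_mul, hexp]))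
    have hza := sub_pos.2 haz'
    filter_upwards [(hIco ha0' haz').eventually_lt_const
      (lt_of_le_of_lt hm (mul_lt_mul_of_pos_right hqa hza))] with i hi
    exact lt_of_mul_lt_mul_right
      ((hlb ha0' haz' (f i) ((hf i).antitoneOn _) (hf0 i z)).trans_lt hi) hza.le

end

/-! ### The skeletons of a stable subordinator -/

theorem stableLevyMeasure_Ioi {α : ℝ} (hα₀ : 0 < α) {t : ℝ} (ht : 0 < t) :
    stableLevyMeasure α (Ioi t) = ENNReal.ofReal (t ^ (-α)) := by
  rw [stableLevyMeasure, withDensity_apply _ measurableSet_Ioi,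
    Measure.restrict_restrict measurableSet_Ioi, Ioi_inter_Ioi, max_eq_left ht.le,
    lintegral_Ioi_rpow hα₀ ht]

theorem integral_stableLevyMeasure {α : ℝ} (hα₀ : 0 < α) (hα₁ : α < 1) {u : ℝ} (hu : 0 < u) :
    ∫ x, (1 - Real.exp (-(u * x))) ∂(stableLevyMeasure α) = u ^ α * Real.Gamma (1 - α) := by
  have hpos : ∀ᵐ x ∂(stableLevyMeasure α), x ∈ Ioi (0 : ℝ) :=
    (withDensity_absolutelyContinuous _ _).ae_le (ae_restrict_mem measurableSet_Ioi)
  have hnn : ∀ᵐ x ∂(stableLevyMeasure α), 0 ≤ 1 - Real.exp (-(u * x)) := by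
    filter_upwards [hpos] with x hx
    have hx' : 0 < x := hx
    have : Real.exp (-(u * x)) ≤ 1 := Real.exp_le_one_iff.2 (by nlinarith)
    linarith
  rw [integral_eq_lintegral_of_nonneg_ae hnn (by fun_prop)]
  nth_rw 1 [← Measure.restrict_eq_self_of_ae_mem hpos]
  rw [lintegral_one_sub_exp _ hu, setLIntegral_congr_fun (g := fun t => ENNReal.ofReal (t ^ (-α)) *
      ENNReal.ofReal (u * Real.exp (-(u * t)))) measurableSet_Ioi
      fun t ht => by simp only; rw [stableLevyMeasure_Ioi hα₀ ht],
    lintegral_rpow_mul_exp hα₁ hu, ENNReal.toReal_ofReal]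
  exact mul_nonneg (by positivity) (Real.Gamma_pos_of_pos (by linarith)).le

theorem convPow_Iio_eq_zero {F : Measure ℝ} [IsProbabilityMeasure F] (hF : F (Iio 0) = 0) (n : ℕ) :
    convPow F n (Iio 0) = 0 := by
  induction n with
  | zero => simp [convPow]
  | succ n ih =>
    have h1 : ∀ᵐ y ∂F, y ∉ Iio (0 : ℝ) := measure_eq_zero_iff_ae_notMem.1 hF
    have h2 : ∀ᵐ x ∂(convPow F n), x ∉ Iio (0 : ℝ) := measure_eq_zero_iff_ae_notMem.1 ih
    rw [convPow, ← lintegral_indicator_one measurableSet_Iio,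
      Measure.lintegral_conv (measurable_one.indicator measurableSet_Iio)]
    refine lintegral_eq_zero_of_ae_eq_zero ?_
    filter_upwards [h2] with x hx
    refine lintegral_eq_zero_of_ae_eq_zero ?_
    filter_upwards [h1] with y hy
    rw [indicator_of_notMem]
    · rfl
    · simp only [mem_Iio, not_lt] at hx hy ⊢
      linarith

theorem tendsto_one_sub_exp_div {ι : Type*} {l : Filter ι} {h : ι → ℝ} (hh : Tendsto h l (𝓝[>] 0))
    (K : ℝ) : Tendsto (fun i => (1 - Real.exp (-(h i * K))) / h i) l (𝓝 K) := by
  have hd : HasDerivAt (fun x : ℝ => 1 - Real.exp (-(x * K))) K 0 := by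
    have := (((hasDerivAt_id (0 : ℝ)).mul_const K).neg.exp).const_sub 1
    convert! this using 1
    simp
  have := (hd.tendsto_slope_zero_right).comp hh
  refine this.congr fun i => ?_
  simp [div_eq_inv_mul]

section

variable {Ω : Type*} [MeasurableSpace Ω] {P : Measure Ω}
  {X : ℝ≥0 → Ω → ℝ} {α : ℝ}

theorem IsPureJumpSubordinator.ae_nonneg {ν : Measure ℝ} (hX : IsPureJumpSubordinator P ν X)
    (t : ℝ≥0) : ∀ᵐ ω ∂P, 0 ≤ X t ω := by
  filter_upwards [hX.start_zero, hX.mono] with ω h0 hm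
  rw [← h0]
  exact hm zero_le

theorem IsPureJumpSubordinator.laplaceTransform_map [IsProbabilityMeasure P]
    (hX : IsPureJumpSubordinator P (stableLevyMeasure α) X) (hα₀ : 0 < α) (hα₁ : α < 1)
    (t : ℝ≥0) {u : ℝ} (hu : 0 < u) : laplaceTransform (P.map (X t)) u =
      ENNReal.ofReal (Real.exp (-(t * (u ^ α * Real.Gamma (1 - α))))) := by
  rw [← integral_stableLevyMeasure hα₀ hα₁ hu, ← hX.laplace t u hu.le, laplaceTransform,
    lintegral_map (by fun_prop) (hX.measurable t), ofReal_integral_eq_lintegral_ofReal]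
  · have hm := hX.measurable t
    refine (integrable_const (1 : ℝ)).mono' (by fun_prop) ?_
    filter_upwards [hX.ae_nonneg t] with ω hω
    rw [Real.norm_of_nonneg (Real.exp_nonneg _)]
    exact Real.exp_le_one_iff.2 (by nlinarith)
  · exact ae_of_all _ fun ω => Real.exp_nonneg _

theorem IsPureJumpSubordinator.lintegral_tail [IsProbabilityMeasure P]
    (hX : IsPureJumpSubordinator P (stableLevyMeasure α) X) (hα₀ : 0 < α) (hα₁ : α < 1)
    (t : ℝ≥0) {u : ℝ} (hu : 0 < u) :
    ∫⁻ s in Ioi 0, P.map (X t) (Ioi s) * ENNReal.ofReal (u * Real.exp (-(u * s))) =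
      ENNReal.ofReal (1 - Real.exp (-(t * (u ^ α * Real.Gamma (1 - α))))) := by
  have := Measure.isProbabilityMeasure_map (μ := P) (hX.measurable t).aemeasurable
  have h := laplaceTransform_add_lintegral (P.map (X t)) hu.le
  have hneg : (P.map (X t)) (Iio 0) = 0 := by
    rw [Measure.map_apply (hX.measurable t) measurableSet_Iio, measure_eq_zero_iff_ae_notMem]
    filter_upwards [hX.ae_nonneg t] with ω hω
    simpa using hω
  rw [setLIntegral_measure_zero _ _ hneg, add_zero, hX.laplaceTransform_map hα₀ hα₁ t hu] at h
  rw [← lintegral_one_sub_exp _ hu, ENNReal.ofReal_sub _ (Real.exp_nonneg _), ENNReal.ofReal_one,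
    ← h, ENNReal.add_sub_cancel_left ENNReal.ofReal_ne_top]

/-- The overshoot theorem for the skeletons of a stable subordinator. -/
theorem IsPureJumpSubordinator.tendsto_exitLaw [IsProbabilityMeasure P]
    (hX : IsPureJumpSubordinator P (stableLevyMeasure α) X) (hα₀ : 0 < α) (hα₁ : α < 1)
    {ι : Type*} {l : Filter ι} {h : ι → ℝ≥0} (hpos : ∀ i, 0 < h i) (hh : Tendsto h l (𝓝 0))
    {y : ℝ} (hy : 0 < y) :
    Tendsto (fun i => exitLaw (P.map (X (h i))) (Ioi (1 + y))) l (𝓝 (dynkinLaw α (Ioi y))) := by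
  have hprob : ∀ i, IsProbabilityMeasure (P.map (X (h i))) := fun i =>
    Measure.isProbabilityMeasure_map (hX.measurable _).aemeasurable
  have hpos' : ∀ i, (0 : ℝ) < h i := hpos
  have hh' : Tendsto (fun i => (h i : ℝ)) l (𝓝[>] 0) :=
    tendsto_nhdsWithin_iff.2 ⟨NNReal.tendsto_coe.2 hh, Eventually.of_forall hpos'⟩
  have hΓ : 0 < Real.Gamma (1 - α) := Real.Gamma_pos_of_pos (by linarith)
  refine tendsto_exitLaw_Ioi (a := fun i => (h i : ℝ)) hα₀ hα₁ (Eventually.of_forall hpos') ?_ ?_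
    ?_ hy
  · intro z hz
    refine tendsto_antitone_of_tendsto_laplaceTransform
      (f := fun i x => (P.map (X (h i))).real (Ioi x) / h i) hα₀ hα₁
      (fun i x w hxw => div_le_div_of_nonneg_right (measureReal_mono (Ioi_subset_Ioi hxw))
        (hpos' i).le) (fun i x => by positivity) (fun u hu => ?_) hz
    have hlim := ENNReal.tendsto_ofReal ((tendsto_one_sub_exp_div hh'
      (u ^ α * Real.Gamma (1 - α))).const_mul u⁻¹)
    have e : u⁻¹ * (u ^ α * Real.Gamma (1 - α)) = (1 / u) ^ (1 - α) * Real.Gamma (1 - α) := by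
      rw [← mul_assoc, one_div, Real.inv_rpow hu.le, ← Real.rpow_neg hu.le, ← Real.rpow_neg_one u,
        ← Real.rpow_add hu]
      ring_nf
    rw [e] at hlim
    refine hlim.congr fun i => ?_
    rw [div_eq_inv_mul, ← mul_assoc, ENNReal.ofReal_mul (by have := hpos' i; positivity),
      ← hX.lintegral_tail hα₀ hα₁ (h i) hu, ← lintegral_const_mul' _ _ ENNReal.ofReal_ne_top]
    refine lintegral_congr fun t => ?_
    have hi := hpos' i
    rw [← ofReal_measureReal, ← ENNReal.ofReal_mul measureReal_nonneg,
      ← ENNReal.ofReal_mul (by positivity), ← ENNReal.ofReal_mul (by positivity)]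
    congr 1
    field_simp
  · intro u hu
    have hK : 0 < u ^ α * Real.Gamma (1 - α) := by positivity
    have := tendsto_mul_inv_one_sub_laplaceTransform (F := fun i => P.map (X (h i)))
      (a := fun i => (h i : ℝ)) (l := l) (u := u) hK (Eventually.of_forall hpos')
      (Eventually.of_forall fun i => by
        rw [hX.laplaceTransform_map hα₀ hα₁ _ hu]; exact ENNReal.ofReal_ne_top)
      ((tendsto_one_sub_exp_div hh' _).congr fun i => by
        rw [hX.laplaceTransform_map hα₀ hα₁ _ hu, ENNReal.toReal_ofReal (Real.exp_nonneg _)])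
    rwa [mul_inv, ← Real.inv_rpow hu.le, ← one_div] at this
  · intro u hu
    refine tendsto_const_nhds.congr fun i => ?_
    rw [setLIntegral_measure_zero, mul_zero]
    rw [renewalMeasure, Measure.sum_apply _ measurableSet_Iio, ENNReal.tsum_eq_zero]
    refine convPow_Iio_eq_zero ?_
    rw [Measure.map_apply (hX.measurable _) measurableSet_Iio, measure_eq_zero_iff_ae_notMem]
    filter_upwards [hX.ae_nonneg (h i)] with ω hω
    simpa using hω

/-- The increments of a process over the intervals of length `h`. -/
noncomputable def skeletonStep (X : ℝ≥0 → Ω → ℝ) (h : ℝ≥0) (j : ℕ) (ω : Ω) : ℝ :=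
  X ((j + 1 : ℕ) * h) ω - X (j * h) ω

theorem walk_skeletonStep {Ω : Type*} (X : ℝ≥0 → Ω → ℝ) (h : ℝ≥0) (k : ℕ) (ω : Ω) :
    walk (skeletonStep X h) k ω = X (k * h) ω - X 0 ω := by
  have := Finset.sum_range_sub (fun j : ℕ => X (j * h) ω) k
  rw [Nat.cast_zero, zero_mul] at this
  exact this

theorem hasIndepSteps_of_iIndepFun {ξ : ℕ → Ω → ℝ} {F : Measure ℝ} (hξ : ∀ i, Measurable (ξ i))
    (hind : iIndepFun ξ P) (hlaw : ∀ i, P.map (ξ i) = F) : HasIndepSteps P ξ F := by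
  intro n A B hA hB
  have h := indep_iSup_of_disjoint (fun i => (hξ i).comap_le) hind.iIndep
    (S := ((Finset.range n : Finset ℕ) : Set ℕ)) (T := {n}) (by simp)
  rw [Indep_iff] at h
  have hB' : MeasurableSet[⨆ i ∈ ({n} : Set ℕ), MeasurableSpace.comap (ξ i) inferInstance]
      (ξ n ⁻¹' B) := by
    rw [iSup_singleton]
    exact ⟨B, hB, rfl⟩
  rw [h A _ hA hB', ← hlaw n, Measure.map_apply (hξ n) hB]

theorem IsPureJumpSubordinator.measurable_skeletonStep {ν : Measure ℝ}
    (hX : IsPureJumpSubordinator P ν X) (h : ℝ≥0) (i : ℕ) : Measurable (skeletonStep X h i) :=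
  (hX.measurable _).sub (hX.measurable _)

theorem IsPureJumpSubordinator.hasIndepSteps {ν : Measure ℝ} (hX : IsPureJumpSubordinator P ν X)
    (h : ℝ≥0) : HasIndepSteps P (skeletonStep X h) (P.map (X h)) := by
  refine hasIndepSteps_of_iIndepFun (hX.measurable_skeletonStep h) ?_ fun i => ?_
  · refine hX.indep_increments.nat (t := fun j : ℕ => (j : ℝ≥0) * h) fun i j hij => ?_
    exact mul_le_mul_left (Nat.cast_le.2 hij) _
  · have := (hX.stationary_increments (i * h) h).map_eq
    rw [← this]
    congr 1
    ext ω
    rw [skeletonStep]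
    congr 2
    push_cast
    ring

theorem IsPureJumpSubordinator.ae_exists_one_le [IsProbabilityMeasure P]
    (hX : IsPureJumpSubordinator P (stableLevyMeasure α) X) (hα₀ : 0 < α) (hα₁ : α < 1) :
    ∀ᵐ ω ∂P, ∃ t, 1 ≤ X t ω := by
  have := Measure.isProbabilityMeasure_map (μ := P) (hX.measurable 1).aemeasurable
  have hΓ : 0 < Real.Gamma (1 - α) := Real.Gamma_pos_of_pos (by linarith)
  have hlt : laplaceTransform (P.map (X 1)) 1 < 1 := by
    rw [hX.laplaceTransform_map hα₀ hα₁ 1 one_pos, ENNReal.ofReal_lt_one, Real.exp_lt_one_iff]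
    simpa using hΓ
  filter_upwards [(hX.hasIndepSteps 1).ae_exists_le_walk (hX.measurable_skeletonStep 1) one_pos hlt
    1, hX.start_zero] with ω ⟨n, hn⟩ h0
  rw [walk_skeletonStep, h0, sub_zero] at hn
  exact ⟨_, hn⟩

theorem one_le_iff_hitOne_le {Ω : Type*} {X : ℝ≥0 → Ω → ℝ} {ω : Ω}
    (hm : Monotone fun t => X t ω) (hc : ∀ t, ContinuousWithinAt (fun s => X s ω) (Ici t) t)
    (hex : ∃ t, 1 ≤ X t ω) (t : ℝ≥0) : 1 ≤ X t ω ↔ hitOne X ω ≤ t := by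
  refine ⟨fun h => csInf_le (OrderBot.bddBelow _) h, fun h => ?_⟩
  refine le_trans ?_ (hm h)
  have hlim : Tendsto (fun s => X s ω) (𝓝[>] (hitOne X ω)) (𝓝 (X (hitOne X ω) ω)) :=
    (hc (hitOne X ω)).mono_left (nhdsWithin_mono _ Ioi_subset_Ici_self)
  refine ge_of_tendsto hlim ?_
  filter_upwards [self_mem_nhdsWithin] with s hs
  obtain ⟨t', ht', hlt⟩ := exists_lt_of_csInf_lt (s := {t : ℝ≥0 | 1 ≤ X t ω}) hex hs
  exact le_trans ht' (hm hlt.le)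

/-- The passage time of the skeleton tends to that of the process from the right. -/
theorem tendsto_walkOvershoot_skeletonStep {Ω : Type*} {X : ℝ≥0 → Ω → ℝ} {ω : Ω} (h0 : X 0 ω = 0)
    (hm : Monotone fun t => X t ω) (hc : ∀ t, ContinuousWithinAt (fun s => X s ω) (Ici t) t)
    (hex : ∃ t, 1 ≤ X t ω) {ι : Type*} {l : Filter ι} {h : ι → ℝ≥0} (hpos : ∀ i, 0 < h i)
    (hh : Tendsto h l (𝓝 0)) :
    Tendsto (fun i => walkOvershoot (skeletonStep X (h i)) 1 ω) l (𝓝 (processOvershoot X ω)) := by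
  set τ := hitOne X ω with hτ
  have hset (i : ι) : {k : ℕ | 1 ≤ walk (skeletonStep X (h i)) k ω} = {k : ℕ | τ ≤ k * h i} := by
    ext k
    rw [mem_ofPred_eq, mem_ofPred_eq, walk_skeletonStep, h0, sub_zero,
      one_le_iff_hitOne_le hm hc hex]
  set k : ι → ℕ := fun i => passageTime (skeletonStep X (h i)) 1 ω with hk
  have hceil (i : ι) : τ ≤ ⌈τ / h i⌉₊ * h i := by
    rw [← div_le_iff₀ (hpos i)]
    exact Nat.le_ceil _
  have h1 (i : ι) : τ ≤ k i * h i := by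
    have : k i ∈ {k : ℕ | τ ≤ k * h i} := by
      rw [hk, ← hset]
      simp only [passageTime]
      refine Nat.sInf_mem ?_
      rw [hset]
      exact ⟨_, hceil i⟩
    exact this
  have h2 (i : ι) : k i * h i ≤ τ + h i := by
    have hle : k i ≤ ⌈τ / h i⌉₊ := by
      simp only [hk, passageTime]
      rw [hset]
      exact Nat.sInf_le (hceil i)
    have hle' : (k i : ℝ≥0) ≤ τ / h i + 1 :=
      (Nat.cast_le.2 hle).trans (Nat.ceil_lt_add_one zero_le).le
    calc k i * h i ≤ (τ / h i + 1) * h i := by gcongr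
      _ = τ + h i := by rw [add_mul, one_mul, div_mul_cancel₀ _ (hpos i).ne']
  have hlim : Tendsto (fun i => (k i : ℝ≥0) * h i) l (𝓝[≥] τ) := by
    refine tendsto_nhdsWithin_iff.2 ⟨?_, Eventually.of_forall h1⟩
    have := (tendsto_const_nhds (x := τ)).add hh
    rw [add_zero] at this
    exact tendsto_of_tendsto_of_tendsto_of_le_of_le tendsto_const_nhds this h1 h2
  have := ((hc τ).tendsto.comp hlim).sub_const 1
  refine this.congr fun i => ?_
  rw [walkOvershoot, walk_skeletonStep, h0, sub_zero]
  rfl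

end

/-! ### The walk under the tilted measure -/

section

variable {Ω : Type*} [MeasurableSpace Ω] {P : Measure Ω} {ξ : ℕ → Ω → ℝ} {γ : ℝ}

theorem isProbabilityMeasure_tiltedLaw {Y : Ω → ℝ} (hY : Measurable Y)
    (h : ∫⁻ ω, ENNReal.ofReal (Real.exp (γ * Y ω)) ∂P = 1) :
    IsProbabilityMeasure (tiltedLaw P Y γ) := by
  refine ⟨?_⟩
  rw [tiltedLaw, withDensity_apply _ MeasurableSet.univ, Measure.restrict_univ,
    lintegral_map (by fun_prop) hY, h]

/-- The left tail of the tilted law is exponentially light, since undoing the tilt leaves a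
finite measure. -/
theorem lintegral_exp_tiltedLaw_ne_top [IsFiniteMeasure P] {Y : Ω → ℝ} (hY : Measurable Y) :
    ∫⁻ x in Iio 0, ENNReal.ofReal (Real.exp (-(γ * x))) ∂(tiltedLaw P Y γ) ≠ ∞ := by
  refine ne_top_of_le_ne_top (measure_ne_top P univ) ?_
  calc ∫⁻ x in Iio 0, ENNReal.ofReal (Real.exp (-(γ * x))) ∂(tiltedLaw P Y γ)
      ≤ ∫⁻ x, ENNReal.ofReal (Real.exp (-(γ * x))) ∂(tiltedLaw P Y γ) :=
        setLIntegral_le_lintegral _ _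
    _ = ∫⁻ x, 1 ∂(P.map Y) := by
        rw [tiltedLaw, lintegral_withDensity_eq_lintegral_mul _ (by fun_prop) (by fun_prop)]
        refine lintegral_congr fun x => ?_
        rw [Pi.mul_apply, ← ENNReal.ofReal_mul (Real.exp_nonneg _), ← Real.exp_add]
        simp
    _ = P univ := by rw [lintegral_one, Measure.map_apply hY MeasurableSet.univ, preimage_univ]

/-- Under the tilted measure the steps are independent and follow the tilted law. -/
theorem IsTiltedMeasure.hasIndepSteps {Q : Measure Ω} (hQ : IsTiltedMeasure P ξ γ Q)
    (hξ : ∀ i, Measurable (ξ i)) (hind : iIndepFun ξ P)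
    (hident : ∀ i, IdentDistrib (ξ i) (ξ 0) P P) : HasIndepSteps Q ξ (tiltedLaw P (ξ 0) γ) := by
  intro n A B hA hB
  have hle := stepAlgebra_le hξ n
  have hA' := hle _ hA
  have hBn : MeasurableSet (ξ n ⁻¹' B) := hξ n hB
  have hmono : stepAlgebra ξ n ≤ stepAlgebra ξ (n + 1) :=
    biSup_mono fun i hi => Finset.range_mono (Nat.le_succ n) hi
  have hn1 : MeasurableSet[stepAlgebra ξ (n + 1)] (ξ n ⁻¹' B) := by
    have h : MeasurableSpace.comap (ξ n) inferInstance ≤ stepAlgebra ξ (n + 1) :=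
      le_iSup₂_of_le n (Finset.self_mem_range_succ n) le_rfl
    exact h _ ⟨B, hB, rfl⟩
  have hF : tiltedLaw P (ξ 0) γ B = ∫⁻ ω, (ξ n ⁻¹' B).indicator
      (fun ω => ENNReal.ofReal (Real.exp (γ * ξ n ω))) ω ∂P := by
    rw [tiltedLaw, withDensity_apply _ hB, ← (hident n).map_eq, lintegral_indicator hBn,
      setLIntegral_map hB (by fun_prop) (hξ n)]
  rw [hQ (n + 1) _ ((hmono _ hA).inter hn1), hQ n A hA, hF, ← lintegral_indicator hA',
    ← lintegral_indicator (hA'.inter hBn)]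
  have hindep : Indep (stepAlgebra ξ n) (MeasurableSpace.comap (ξ n) inferInstance) P := by
    have h := indep_iSup_of_disjoint (fun i => (hξ i).comap_le) hind.iIndep
      (S := ((Finset.range n : Finset ℕ) : Set ℕ)) (T := {n}) (by simp)
    rw [iSup_singleton] at h
    exact h
  rw [← lintegral_mul_eq_lintegral_mul_lintegral_of_independent_measurableSpace hle
    (hξ n).comap_le hindep]
  · refine lintegral_congr fun ω => ?_
    by_cases h1 : ω ∈ A
    · by_cases h2 : ω ∈ ξ n ⁻¹' B
      · rw [indicator_of_mem (mem_inter h1 h2), indicator_of_mem h1, indicator_of_mem h2,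
          ← ENNReal.ofReal_mul (Real.exp_nonneg _), ← Real.exp_add, walk_succ, mul_add]
      · rw [indicator_of_notMem (fun h => h2 h.2), indicator_of_notMem h2, mul_zero]
    · rw [indicator_of_notMem (fun h => h1 h.1), indicator_of_notMem h1, zero_mul]
  · have hw := measurable_walk_stepAlgebra ξ (le_refl n)
    exact Measurable.indicator
      (((hw.const_mul γ).exp).ennreal_ofReal) hA
  · exact Measurable.indicator
      ((((comap_measurable (ξ n)).const_mul γ).exp).ennreal_ofReal) ⟨B, hB, rfl⟩

end

/-! ### Convergence in distribution from convergence of tails -/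

section

variable {ι : Type*} {l : Filter ι} {Ω : ι → Type*} {Ω' : Type*} {m : ∀ i, MeasurableSpace (Ω i)}
  {m' : MeasurableSpace Ω'} {μ : ∀ i, Measure (Ω i)} [∀ i, IsProbabilityMeasure (μ i)]
  {μ' : Measure Ω'} [IsProbabilityMeasure μ']

/-- Convergence of the tails at all positive arguments implies convergence in distribution, when
the limit law lives on the positive half-line. -/
theorem tendstoInDistribution_of_tendsto_tail [l.IsCountablyGenerated] {Y : ∀ i, Ω i → ℝ}
    {Z : Ω' → ℝ} (hY : ∀ i, AEMeasurable (Y i) (μ i)) (hZ : AEMeasurable Z μ')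
    (hpos : μ'.map Z (Ioi 0) = 1)
    (h : ∀ y, 0 < y → Tendsto (fun i => (μ i).map (Y i) (Ioi y)) l (𝓝 (μ'.map Z (Ioi y)))) :
    TendstoInDistribution Y l Z μ μ' := by
  have hprob : ∀ i, IsProbabilityMeasure ((μ i).map (Y i)) := fun i =>
    Measure.isProbabilityMeasure_map (hY i)
  have hprob' : IsProbabilityMeasure (μ'.map Z) := Measure.isProbabilityMeasure_map hZ
  have hall (a : ℝ) : Tendsto (fun i => (μ i).map (Y i) (Ioi a)) l (𝓝 (μ'.map Z (Ioi a))) := by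
    rcases lt_or_ge 0 a with ha | ha
    · exact h a ha
    have h1 : μ'.map Z (Ioi a) = 1 :=
      le_antisymm prob_le_one (hpos ▸ measure_mono (Ioi_subset_Ioi ha))
    rw [h1]
    refine tendsto_order.2 ⟨fun q hq => ?_, fun q hq => Eventually.of_forall fun i =>
      prob_le_one.trans_lt hq⟩
    have hU : Ioi (0 : ℝ) = ⋃ n : ℕ, Ioi (1 / ((n : ℝ) + 1)) := by
      ext x
      simp only [mem_Ioi, mem_iUnion]
      exact ⟨fun hx => exists_nat_one_div_lt hx, fun ⟨n, hn⟩ => lt_trans (by positivity) hn⟩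
    have hmono : Monotone fun n : ℕ => Ioi (1 / ((n : ℝ) + 1)) := fun n k hnk =>
      Ioi_subset_Ioi (one_div_le_one_div_of_le (by positivity) (by gcongr))
    have hlim := tendsto_measure_iUnion_atTop (μ := μ'.map Z) hmono
    rw [← hU, hpos] at hlim
    obtain ⟨n, hn⟩ := (hlim.eventually_const_lt hq).exists
    have hn0 : (0 : ℝ) < 1 / ((n : ℝ) + 1) := by positivity
    filter_upwards [(h _ hn0).eventually_const_lt hn] with i hi
    exact hi.trans_le (measure_mono (Ioi_subset_Ioi (ha.trans hn0.le)))
  refine ⟨hY, hZ, ?_⟩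
  refine (isPiSystem_Ioc (id : ℝ → ℝ) (id : ℝ → ℝ)).tendsto_probabilityMeasure_of_tendsto_of_mem
    ?_ ?_ ?_
  · rintro s ⟨a, b, -, rfl⟩
    exact measurableSet_Ioc
  · intro u hu x hx
    obtain ⟨ε, hε, hsub⟩ := Metric.isOpen_iff.1 hu x hx
    refine ⟨Ioc (x - ε / 2) (x + ε / 2), ⟨x - ε / 2, x + ε / 2, by simp only [id]; linarith, rfl⟩,
      Ioc_mem_nhds (by linarith) (by linarith), fun w hw => hsub ?_⟩
    rw [Metric.mem_ball, Real.dist_eq, abs_lt]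
    constructor <;> linarith [hw.1, hw.2]
  · rintro s ⟨a, b, hab, rfl⟩
    have hab' : a ≤ b := le_of_lt hab
    have hd (ν : Measure ℝ) [IsFiniteMeasure ν] : ν (Ioc a b) = ν (Ioi a) - ν (Ioi b) := by
      have hs : Ioi a \ Ioi b = Ioc a b := by ext x; simp
      rw [← hs, measure_sdiff (Ioi_subset_Ioi hab') measurableSet_Ioi.nullMeasurableSet
        (measure_ne_top _ _)]
    refine (ENNReal.tendsto_toNNReal (measure_ne_top (μ'.map Z) _)).comp ?_
    change Tendsto (fun i => (μ i).map (Y i) (Ioc a b)) l (𝓝 (μ'.map Z (Ioc a b)))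
    simp only [hd]
    exact ENNReal.Tendsto.sub (hall a) (hall b) (Or.inl (measure_ne_top _ _))

end

end RandomWalkOvershoot

open RandomWalkOvershoot
theorem lemmaA3 {Ω Ω' : Type*} [MeasurableSpace Ω] [MeasurableSpace Ω']
    -- the random walk, in the Cramér case with infinite tilted mean
    (P : Measure Ω) [IsProbabilityMeasure P]
    (ξ : ℕ → Ω → ℝ) (hξ_meas : ∀ i, Measurable (ξ i))
    (hξ_indep : iIndepFun ξ P) (hξ_ident : ∀ i, IdentDistrib (ξ i) (ξ 0) P P)
    -- negative mean, the value `-∞` being allowed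
    (hξ_mean : ∫⁻ ω, ENNReal.ofReal (ξ 0 ω) ∂P < ∫⁻ ω, ENNReal.ofReal (-ξ 0 ω) ∂P)
    (γ : ℝ) (hγ : 0 < γ)
    (hγ_one : ∫⁻ ω, ENNReal.ofReal (Real.exp (γ * ξ 0 ω)) ∂P = 1)
    -- the negative part of `x * exp (γ * x)` is bounded, so this says that the mean is `+∞`
    (hγ_top : ∫⁻ ω, ENNReal.ofReal (ξ 0 ω * Real.exp (γ * ξ 0 ω)) ∂P = ∞)
    -- the tilted measure
    (Pstar : Measure Ω) [IsProbabilityMeasure Pstar] (hPstar : IsTiltedMeasure P ξ γ Pstar)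
    -- regular variation of the right tail of the tilted distribution
    (α : ℝ) (hα₀ : 0 < α) (hα₁ : α < 1)
    (hF : IsRegularlyVarying (fun x => (tiltedLaw P (ξ 0) γ).real (Ioi x)) (-α))
    -- the stable subordinator
    (P' : Measure Ω') [IsProbabilityMeasure P'] (X : ℝ≥0 → Ω' → ℝ)
    (hX : IsPureJumpSubordinator P' (stableLevyMeasure α) X) :
    (∀ r : ℝ, 0 < r → ∀ᵐ ω ∂Pstar, ∃ n, r ≤ walk ξ n ω) ∧
    (∀ᵐ ω ∂P', ∃ t, 1 ≤ X t ω) ∧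
    TendstoInDistribution (fun (r : ℝ) ω => walkOvershoot ξ r ω / r) atTop
      (processOvershoot X) (fun _ => Pstar) P' ∧
    P'.map (processOvershoot X) = dynkinLaw α := by
  set F := tiltedLaw P (ξ 0) γ with hFdef
  have hFprob : IsProbabilityMeasure F := isProbabilityMeasure_tiltedLaw (hξ_meas 0) hγ_one
  have hDprob := isProbabilityMeasure_dynkinLaw hα₀ hα₁
  have hleft : ∫⁻ x in Iio 0, ENNReal.ofReal (Real.exp (-(γ * x))) ∂F ≠ ∞ :=
    lintegral_exp_tiltedLaw_ne_top (hξ_meas 0)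
  have hsteps : HasIndepSteps Pstar ξ F := hPstar.hasIndepSteps hξ_meas hξ_indep hξ_ident
  have hex := hX.ae_exists_one_le hα₀ hα₁
  -- the overshoots of the skeletons with mesh `1 / (n + 1)`
  set h : ℕ → ℝ≥0 := fun n => 1 / ((n : ℝ≥0) + 1) with hh
  have hhpos : ∀ n, 0 < h n := fun n => by positivity
  have hhlim : Tendsto h atTop (𝓝 0) := tendsto_one_div_add_atTop_nhds_zero_nat
  set Y : ℕ → Ω' → ℝ := fun n => walkOvershoot (skeletonStep X (h n)) 1 with hY
  have hYm : ∀ n, Measurable (Y n) := fun n =>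
    measurable_walkOvershoot (hX.measurable_skeletonStep (h n)) 1
  have hYlim : ∀ᵐ ω ∂P', Tendsto (fun n => Y n ω) atTop (𝓝 (processOvershoot X ω)) := by
    filter_upwards [hX.start_zero, hX.mono, hX.right_continuous, hex] with ω h1 h2 h3 h4
    exact tendsto_walkOvershoot_skeletonStep h1 h2 h3 h4 hhpos hhlim
  have hχm : AEMeasurable (processOvershoot X) P' :=
    aemeasurable_of_tendsto_metrizable_ae atTop (fun n => (hYm n).aemeasurable) hYlim
  have hlaw : P'.map (processOvershoot X) = dynkinLaw α := by
    have d1 := tendstoInDistribution_of_ae_tendsto (fun n => (hYm n).aemeasurable) hχm hYlim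
    have d2 : TendstoInDistribution Y atTop (id : ℝ → ℝ) (fun _ => P') (dynkinLaw α) := by
      refine tendstoInDistribution_of_tendsto_tail (fun n => (hYm n).aemeasurable)
        aemeasurable_id ?_ fun y hy => ?_
      · rw [Measure.map_id, dynkinLaw_Ioi_zero hα₀ hα₁]
      · rw [Measure.map_id]
        refine (hX.tendsto_exitLaw hα₀ hα₁ hhpos hhlim hy).congr fun n => ?_
        have := Measure.isProbabilityMeasure_map (μ := P') (hX.measurable (h n)).aemeasurable
        rw [← measure_walkOvershoot_gt (hX.hasIndepSteps (h n))
          (hX.measurable_skeletonStep (h n)) hy.le, Measure.map_apply (hYm n) measurableSet_Ioi]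
        rfl
    have := tendstoInDistribution_unique Y d1 d2
    rwa [Measure.map_id] at this
  refine ⟨fun r _ => ?_, hex, ?_, hlaw⟩
  · obtain ⟨v, hv, hv1⟩ := exists_laplaceTransform_lt_one hα₀ hα₁ hF hγ hleft
    exact hsteps.ae_exists_le_walk hξ_meas hv hv1 r
  · have hm : ∀ r : ℝ, Measurable fun ω => walkOvershoot ξ r ω / r := fun r =>
      (measurable_walkOvershoot hξ_meas r).div_const r
    refine tendstoInDistribution_of_tendsto_tail (fun r => (hm r).aemeasurable) hχm ?_
      fun y hy => ?_
    · rw [hlaw, dynkinLaw_Ioi_zero hα₀ hα₁]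
    · rw [hlaw]
      refine (tendsto_exitLaw_map_div hα₀ hα₁ hF hγ hleft hy).congr' ?_
      filter_upwards [eventually_gt_atTop 0] with r hr
      have := Measure.isProbabilityMeasure_map (μ := F) (f := fun x => x / r) (by fun_prop)
      rw [Measure.map_apply (hm r) measurableSet_Ioi,
        ← measure_walkOvershoot_gt (hsteps.comp (g := fun x => x / r) (by fun_prop))
          (fun i => (hξ_meas i).div_const r) hy.le]
      congr 1
      ext ω
      rw [mem_ofPred_eq, walkOvershoot_div ξ hr]
      rfl
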